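/- Let $N\in\mathbb N_0$, let $x_1<\dots<x_N$ be real, and for $n=1,\dots,N$ let $\omega_n\in\mathbb R$, $\upsilon_n\ge 0$ with $|\omega_n|+\upsilon_n>0$. Put $\omega=\sum_{n=1}^N\omega_n\delta_{x_n}$ and $\upsilon=\sum_{n=1}^N\upsilon_n\delta_{x_n}$. For $z\in\mathbb C$, a solution of $$-f''+\tfrac14 f=z\,\omega f+z^2\upsilon f \qquad (*)$$ is a continuous function $f:\mathbb R\to\mathbb C$ with $f''=\tfrac14 f$ on $\mathbb R\setminus\{x_1,\dots,x_N\}$ and $f'(x_n-)=f'(x_n+)+(z\omega_n+z^2\upsilon_n)f(x_n)$ for every $n$. The spectrum $\sigma$ is the set of all $z\in\mathbb C$ for which $(*)$ has a nontrivial bounded solution, and $|\sigma|$ is its number of elements. Let $\phi_+(z,\cdot)$ be the solution of $(*)$ with $\phi_+(z,x)=e^{-x/2}$ for all $x$ near $+\infty$, and for $\lambda\in\sigma$ let $$\gamma_\lambda^2=\int_{\mathbb R}|\phi_+(\lambda,x)|^2\,d\omega(x)+2\lambda\int_{\mathbb R}|\phi_+(\lambda,x)|^2\,d\upsilon(x)$$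 be the (modified) norming constant. Then $\sigma$ is a finite set of real numbers and $\lambda\gamma_\lambda^2>0$ for every $\lambda\in\sigma$. Put $$s_k=\sum_{\lambda\in\sigma}\frac{\lambda^k}{\lambda\gamma_\lambda^2}\quad(k\ge 1),\qquad \Delta_{1,k}=\det\,(s_{i+j-1})_{i,j=1}^{k},$$ so that $\Delta_{1,1},\dots,\Delta_{1,|\sigma|}$ are the leading principal minors of the moment matrix $(s_{i+j-1})_{i,j=1}^{|\sigma|}$. The following hold. (i) $\upsilon=0$ if and only if $\Delta_{1,k}\neq0$ for all $k=1,\dots,|\sigma|$. (ii) If $\eta_+$ denotes the number of nonzero elements among $\upsilon_1,\dots,\upsilon_N$ and $\kappa_0$ the number of zero elements among $\Delta_{1,1},\dots,\Delta_{1,|\sigma|}$, then $|\sigma|-N=\eta_+=\kappa_0$. (iii) If $\upsilon=0$, then $\omega$ is non-negative if and only if $\Delta_{1,k}>0$ for all $k=1,\dots,|\sigma|$, and $\omega$ is non-positive if and only if $(-1)^k\Delta_{1,k}>0$ for all $k=1,\dots,|\sigma|$. -/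

import Mathlib

open Filter Topology MeasureTheory
open scoped ComplexOrder

noncomputable section

namespace MultiPeakon

/-- The data of the two discrete measures `ω = ∑ ω_n δ_{x_n}` and `υ = ∑ υ_n δ_{x_n}`: strictly
increasing points `x_n`, real weights `ω_n`, nonnegative weights `υ_n`, and no superfluous points
(`|ω_n| + υ_n > 0`). -/
structure DiscreteData (N : ℕ) where
  /-- the points `x_1 < ... < x_N` -/
  x : Fin N → ℝ
  /-- the weights `ω_n` -/
  w : Fin N → ℝ
  /-- the weights `υ_n` -/
  v : Fin N → ℝ
  strictMono_x : StrictMono x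
  v_nonneg : ∀ n, 0 ≤ v n
  weight_pos : ∀ n, 0 < |w n| + v n

variable {N : ℕ}

namespace DiscreteData

/-- The signed measure `ω = ∑ ω_n δ_{x_n}`. -/
def omega (d : DiscreteData N) : SignedMeasure ℝ :=
  ∑ n, VectorMeasure.dirac (d.x n) (d.w n)

/-- The nonnegative measure `υ = ∑ υ_n δ_{x_n}`. -/
def upsilon (d : DiscreteData N) : Measure ℝ :=
  ∑ n, ENNReal.ofReal (d.v n) • Measure.dirac (d.x n)

/-- The coefficient `z ω_n + z² υ_n` in the interface condition at `x_n`. -/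
def coef (d : DiscreteData N) (z : ℂ) (n : Fin N) : ℂ :=
  z * (d.w n : ℂ) + z ^ 2 * (d.v n : ℂ)

/-- `f` is a solution of `-f'' + f / 4 = z ω f + z² υ f`: it is continuous, satisfies
`f'' = f / 4` away from the points `x_n`, and `f'(x_n-) = f'(x_n+) + (z ω_n + z² υ_n) f(x_n)`.
The function `g` is `f'`, extended to the points `x_n` by left-continuity. -/
def IsSolution (d : DiscreteData N) (z : ℂ) (f : ℝ → ℂ) : Prop :=
  Continuous f ∧ ∃ g : ℝ → ℂ,
    (∀ x, x ∉ Set.range d.x → HasDerivAt f (g x) x ∧ HasDerivAt g (f x / 4) x) ∧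
    ∀ n, Tendsto g (𝓝[<] (d.x n)) (𝓝 (g (d.x n))) ∧
      ∃ b : ℂ, Tendsto g (𝓝[>] (d.x n)) (𝓝 b) ∧
        g (d.x n) = b + d.coef z n * f (d.x n)

/-- The spectrum: all `z ∈ ℂ` for which there is a nontrivial bounded solution. -/
def spectrum (d : DiscreteData N) : Set ℂ :=
  {z | ∃ f : ℝ → ℂ, d.IsSolution z f ∧ f ≠ 0 ∧ ∃ C : ℝ, ∀ x, ‖f x‖ ≤ C}

/-- The values `φ₊(z, x_n)`, computed from the right to the left. -/
def phiPlusNode (d : DiscreteData N) (z : ℂ) (n : Fin N) : ℂ :=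
  (Real.exp (-d.x n / 2) : ℂ) + ∑ k : Fin N,
    if _h : n < k then
      d.coef z k * (2 * Real.sinh ((d.x n - d.x k) / 2) : ℝ) * phiPlusNode d z k
    else 0
termination_by N - n.val
decreasing_by
  have := k.isLt
  have := n.isLt
  have : n.val < k.val := _h
  omega

/-- The solution `φ₊(z, ·)` with `φ₊(z, x) = e^{-x/2}` for all `x` near `+∞`
(see `phiPlus_isSolution` and `phiPlus_eventually`). -/
def phiPlus (d : DiscreteData N) (z : ℂ) (x : ℝ) : ℂ :=
  (Real.exp (-x / 2) : ℂ) + ∑ k : Fin N,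
    if x ≤ d.x k then
      d.coef z k * (2 * Real.sinh ((x - d.x k) / 2) : ℝ) * d.phiPlusNode z k
    else 0

/-- The (modified) norming constant
`γ_λ² = ∫ |φ₊(λ, x)|² dω(x) + 2 λ ∫ |φ₊(λ, x)|² dυ(x)`. -/
def normingConst (d : DiscreteData N) (l : ℂ) : ℂ :=
  ((d.omega.integral (fun x => ‖d.phiPlus l x‖ ^ 2) (ContinuousLinearMap.lsmul ℝ ℝ) : ℝ) : ℂ) +
    2 * l * ((∫ x, ‖d.phiPlus l x‖ ^ 2 ∂d.upsilon : ℝ) : ℂ)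

/-- The moments `s_k = ∑_{λ ∈ σ} λ^k / (λ γ_λ²)`. -/
def moment (d : DiscreteData N) (k : ℕ) : ℂ :=
  ∑ᶠ l ∈ d.spectrum, l ^ k / (l * d.normingConst l)

/-- The Hankel minor `Δ_{1,k} = det (s_{i+j-1})_{i,j = 1, ..., k}`. -/
def hankelMinor (d : DiscreteData N) (k : ℕ) : ℂ :=
  (Matrix.of fun i j : Fin k => d.moment (i.val + j.val + 1)).det

/-- The number `η₊` of nonzero elements among `υ_1, ..., υ_N`. -/
def etaPlus (d : DiscreteData N) : ℕ := {n : Fin N | d.v n ≠ 0}.ncard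

/-- The number `κ₀` of zero elements among `Δ_{1,1}, ..., Δ_{1,|σ|}`. -/
def kappaZero (d : DiscreteData N) : ℕ :=
  {k : ℕ | 1 ≤ k ∧ k ≤ d.spectrum.ncard ∧ d.hankelMinor k = 0}.ncard

/-! Sanity checks: `φ₊` is the solution it is meant to be, and the norming constant is the
expected finite sum. -/

theorem phiPlus_node (d : DiscreteData N) (z : ℂ) (n : Fin N) :
    d.phiPlus z (d.x n) = d.phiPlusNode z n := by
  rw [phiPlusNode, phiPlus]
  congr 1
  refine Finset.sum_congr rfl fun k _ => ?_
  simp only [d.strictMono_x.le_iff_le]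
  by_cases h : n < k
  · simp [h, h.le]
  · by_cases h' : n = k
    · subst h'; simp
    · have : ¬ n ≤ k := fun h2 => h (lt_of_le_of_ne h2 h')
      simp [h, this]

theorem phiPlus_eventually (d : DiscreteData N) (z : ℂ) :
    ∀ᶠ x in atTop, d.phiPlus z x = (Real.exp (-x / 2) : ℂ) := by
  have : ∀ᶠ x in atTop, ∀ k, d.x k < x :=
    eventually_all.2 fun k => eventually_gt_atTop (d.x k)
  filter_upwards [this] with x hx
  simp [phiPlus, fun k => not_le.2 (hx k)]

theorem phiPlus_isSolution (d : DiscreteData N) (z : ℂ) :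
    d.IsSolution z (d.phiPlus z) := by
  set A : Fin N → ℂ := fun k => d.coef z k * d.phiPlusNode z k with hA
  have e1 : d.phiPlus z = fun x => (Real.exp (-x / 2) : ℂ) +
      ∑ k, A k * ((2 * Real.sinh (min (x - d.x k) 0 / 2) : ℝ) : ℂ) := by
    funext x
    rw [phiPlus]
    congr 1
    refine Finset.sum_congr rfl fun k _ => ?_
    split_ifs with h
    · rw [min_eq_left (by linarith), hA]; ring
    · rw [min_eq_right (by linarith)]; simp
  have E1 : ∀ x : ℝ, HasDerivAt (fun x : ℝ => (Real.exp (-x / 2) : ℂ))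
      (-(1 / 2) * (Real.exp (-x / 2) : ℂ)) x := fun x => by
    have h : HasDerivAt (fun x : ℝ => Real.exp (-x / 2)) (Real.exp (-x / 2) * (-1 / 2)) x :=
      ((hasDerivAt_id x).neg.div_const 2).exp
    convert h.ofReal_comp using 1
    push_cast; ring
  have S1 : ∀ (k : Fin N) (x : ℝ), HasDerivAt
      (fun x : ℝ => A k * ((2 * Real.sinh ((x - d.x k) / 2) : ℝ) : ℂ))
      (A k * (Real.cosh ((x - d.x k) / 2) : ℂ)) x := fun k x => by
    have h : HasDerivAt (fun x : ℝ => 2 * Real.sinh ((x - d.x k) / 2))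
        (2 * (Real.cosh ((x - d.x k) / 2) * (1 / 2))) x :=
      ((((hasDerivAt_id x).sub_const (d.x k)).div_const 2).sinh).const_mul 2
    refine (h.ofReal_comp.const_mul (A k)).congr_deriv ?_
    push_cast; ring
  have C1 : ∀ (k : Fin N) (x : ℝ), HasDerivAt
      (fun x : ℝ => A k * (Real.cosh ((x - d.x k) / 2) : ℂ))
      (A k * ((2 * Real.sinh ((x - d.x k) / 2) : ℝ) : ℂ) / 4) x := fun k x => by
    have h : HasDerivAt (fun x : ℝ => Real.cosh ((x - d.x k) / 2))
        (Real.sinh ((x - d.x k) / 2) * (1 / 2)) x :=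
      (((hasDerivAt_id x).sub_const (d.x k)).div_const 2).cosh
    refine (h.ofReal_comp.const_mul (A k)).congr_deriv ?_
    push_cast; ring
  refine ⟨by rw [e1]; fun_prop, fun x => -(1 / 2) * (Real.exp (-x / 2) : ℂ) +
    ∑ k, if x ≤ d.x k then A k * (Real.cosh ((x - d.x k) / 2) : ℂ) else 0, ?_, ?_⟩
  · intro x hx
    have hne : ∀ k, d.x k ≠ x := fun k h => hx ⟨k, h⟩
    have ev : ∀ k, ∀ᶠ y in 𝓝 x, (y ≤ d.x k ↔ x ≤ d.x k) := fun k => by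
      rcases lt_or_gt_of_ne (hne k) with h | h
      · filter_upwards [lt_mem_nhds h] with y hy
        simp [not_le.2 h, not_le.2 hy]
      · filter_upwards [gt_mem_nhds h] with y hy
        simp [h.le, le_of_lt hy]
    constructor
    · unfold phiPlus
      refine (E1 x).add (HasDerivAt.fun_sum fun k _ => ?_)
      by_cases h : x ≤ d.x k
      · simp only [if_pos h]
        refine (S1 k x).congr_of_eventuallyEq ?_
        filter_upwards [ev k] with y hy
        rw [if_pos (hy.2 h), hA]; ring
      · simp only [if_neg h]
        refine (hasDerivAt_const x (0 : ℂ)).congr_of_eventuallyEq ?_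
        filter_upwards [ev k] with y hy
        rw [if_neg (fun h' => h (hy.1 h'))]
    · have key : d.phiPlus z x / 4 = -(1 / 2) * (-(1 / 2) * (Real.exp (-x / 2) : ℂ)) +
          ∑ k, if x ≤ d.x k then A k * ((2 * Real.sinh ((x - d.x k) / 2) : ℝ) : ℂ) / 4
            else 0 := by
        rw [phiPlus, add_div, Finset.sum_div]
        congr 1
        · ring
        · refine Finset.sum_congr rfl fun k _ => ?_
          split_ifs
          · rw [hA]; ring
          · simp
      rw [key]
      refine ((E1 x).const_mul _).add (HasDerivAt.fun_sum fun k _ => ?_)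
      by_cases h : x ≤ d.x k
      · simp only [if_pos h]
        refine (C1 k x).congr_of_eventuallyEq ?_
        filter_upwards [ev k] with y hy
        rw [if_pos (hy.2 h)]
      · simp only [if_neg h]
        refine (hasDerivAt_const x (0 : ℂ)).congr_of_eventuallyEq ?_
        filter_upwards [ev k] with y hy
        rw [if_neg (fun h' => h (hy.1 h'))]
  · intro n
    have hE : Tendsto (fun x : ℝ => -(1 / 2) * (Real.exp (-x / 2) : ℂ)) (𝓝 (d.x n))
        (𝓝 (-(1 / 2) * (Real.exp (-d.x n / 2) : ℂ))) :=
      ((E1 (d.x n)).const_mul _).continuousAt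
    constructor
    · refine (hE.mono_left nhdsWithin_le_nhds).add (tendsto_finsetSum _ fun k _ => ?_)
      by_cases h : d.x n ≤ d.x k
      · simp only [if_pos h]
        refine Tendsto.congr' ?_ ((C1 k (d.x n)).continuousAt.tendsto.mono_left nhdsWithin_le_nhds)
        filter_upwards [self_mem_nhdsWithin] with y hy
        rw [if_pos (le_of_lt (lt_of_lt_of_le hy h))]
      · simp only [if_neg h]
        refine Tendsto.congr' ?_ tendsto_const_nhds
        filter_upwards [nhdsWithin_le_nhds (lt_mem_nhds (not_le.1 h))] with y hy
        rw [if_neg (not_le.2 hy)]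
    · refine ⟨-(1 / 2) * (Real.exp (-d.x n / 2) : ℂ) +
        ∑ k, if d.x n < d.x k then A k * (Real.cosh ((d.x n - d.x k) / 2) : ℂ) else 0, ?_, ?_⟩
      · refine (hE.mono_left nhdsWithin_le_nhds).add (tendsto_finsetSum _ fun k _ => ?_)
        by_cases h : d.x n < d.x k
        · simp only [if_pos h]
          refine Tendsto.congr' ?_
            ((C1 k (d.x n)).continuousAt.tendsto.mono_left nhdsWithin_le_nhds)
          filter_upwards [nhdsWithin_le_nhds (gt_mem_nhds h)] with y hy
          rw [if_pos (le_of_lt hy)]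
        · simp only [if_neg h]
          refine Tendsto.congr' ?_ tendsto_const_nhds
          filter_upwards [self_mem_nhdsWithin] with y hy
          rw [if_neg (not_le.2 (lt_of_le_of_lt (not_lt.1 h) hy))]
      · beta_reduce
        have : d.coef z n * d.phiPlus z (d.x n) = ∑ k, if k = n then A k else 0 := by
          simp [phiPlus_node, hA]
        rw [this, add_assoc, ← Finset.sum_add_distrib]
        congr 1
        refine Finset.sum_congr rfl fun k _ => ?_
        simp only [d.strictMono_x.le_iff_le, d.strictMono_x.lt_iff_lt]
        rcases lt_trichotomy n k with h | h | h
        · simp [h, h.le, h.ne']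
        · subst h; simp
        · simp [not_le.2 h, not_lt.2 h.le, h.ne]

theorem phiPlus_continuous (d : DiscreteData N) (z : ℂ) : Continuous (d.phiPlus z) :=
  (d.phiPlus_isSolution z).1

theorem normingConst_eq_sum (d : DiscreteData N) (l : ℂ) :
    d.normingConst l = ∑ n, (((‖d.phiPlus l (d.x n)‖ ^ 2 : ℝ) : ℂ)) *
      ((d.w n : ℂ) + 2 * l * (d.v n : ℂ)) := by
  have hint : ∀ a : ℝ, Integrable (fun x => ‖d.phiPlus l x‖ ^ 2) (Measure.dirac a) := fun a =>
    integrable_dirac (by simp)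
  have h1 : d.omega.integral (fun x => ‖d.phiPlus l x‖ ^ 2) (ContinuousLinearMap.lsmul ℝ ℝ) =
      ∑ n, ‖d.phiPlus l (d.x n)‖ ^ 2 * d.w n := by
    rw [omega, VectorMeasure.integral_finsetSum_vectorMeasure]
    · simp [VectorMeasure.integral_dirac]
    · intro n _
      rw [VectorMeasure.Integrable, VectorMeasure.variation_dirac]
      exact (hint _).smul_measure (by simp)
  have h2 : ∫ x, ‖d.phiPlus l x‖ ^ 2 ∂d.upsilon =
      ∑ n, ‖d.phiPlus l (d.x n)‖ ^ 2 * d.v n := by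
    rw [upsilon, integral_finsetSum_measure]
    · refine Finset.sum_congr rfl fun n _ => ?_
      rw [integral_smul_measure, integral_dirac, ENNReal.toReal_ofReal (d.v_nonneg n),
        smul_eq_mul, mul_comm]
    · intro n _
      exact (hint _).smul_measure ENNReal.ofReal_ne_top
  rw [normingConst, h1, h2]
  push_cast
  rw [Finset.mul_sum, ← Finset.sum_add_distrib]
  exact Finset.sum_congr rfl fun n _ => by ring

end DiscreteData

end MultiPeakon

end

/-! The value `φ₊(z, x_n)` is a real polynomial in `z` (`nodePoly`), and so is the coefficient
`W(z)` of `e^{-x/2}` in `φ₊(z, ·)` near `-∞` (`charPoly`). A bounded solution satisfies the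
homogeneous Green equation with kernel `e^{-|x-y|/2}`, which makes it a multiple of `φ₊`; hence `σ`
is the zero set of `W` (`mem_spectrum_iff`). The kernel is positive semidefinite, and the resulting
energy identity forces the zeros to be real with `λ γ_λ² > 0`. A Wronskian-type identity
(`charPoly_mul_eq`) makes them simple and the eigenfunctions orthogonal. Since `W` has degree `N +
η₊`, this gives `|σ| = N + η₊`.

The moments are `s_{k+1} = L(X^k)` for the functional `L(p) = ∑ p(λ) / γ_λ²`. The polynomials `φ_n`,
together with `X φ_n` when `υ_n ≠ 0`, have each of the degrees `0, ..., |σ| - 1` exactly once.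
Orthogonality over `σ`, read as a square matrix identity and transposed, becomes biorthogonality
under `L` (`momentFunctional_dual_mul`). In this triangular basis the Hankel form is block diagonal,
with a block `1/ω_n` if `υ_n = 0` and a block `[[0, 1/υ_n], [1/υ_n, *]]` otherwise. A leading minor
vanishes exactly when it cuts a `2 × 2` block in half, and there is one such minor for each `υ_n ≠
0`: this yields (i) and (ii). If `υ = 0`, then up to squares the minors are products of the `1/ω_n`,
taken from the right, which yields (iii). -/

namespace MultiPeakon

namespace DiscreteData

open Polynomial

variable {N : ℕ}

/-! ### Green's function and the polynomial form of `φ₊`. -/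

/-- Green's function of `-f'' + f / 4`, up to normalization. -/
noncomputable def green (x y : ℝ) : ℝ := Real.exp (-|x - y| / 2)

theorem green_of_le {x y : ℝ} (h : x ≤ y) :
    green x y = Real.exp (x / 2) * Real.exp (-y / 2) := by
  rw [green, abs_of_nonpos (by linarith), ← Real.exp_add]
  congr 1; ring

theorem green_of_ge {x y : ℝ} (h : y ≤ x) :
    green x y = Real.exp (-x / 2) * Real.exp (y / 2) := by
  rw [green, abs_of_nonneg (by linarith), ← Real.exp_add]
  congr 1; ring

theorem green_comm (x y : ℝ) : green x y = green y x := by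
  rw [green, green, abs_sub_comm]

theorem green_pos (x y : ℝ) : 0 < green x y := Real.exp_pos _

theorem green_le_one (x y : ℝ) : green x y ≤ 1 := by
  rw [green, Real.exp_le_one_iff]
  have := abs_nonneg (x - y)
  linarith

theorem two_mul_sinh_half_sub (x y : ℝ) (h : x ≤ y) :
    2 * Real.sinh ((x - y) / 2) = green x y - Real.exp (-x / 2) * Real.exp (y / 2) := by
  rw [green_of_le h, Real.sinh_eq, ← Real.exp_add, ← Real.exp_add]
  ring_nf

/-- The coefficient `z ω_n + z² υ_n` as a polynomial in `z`. -/
noncomputable def coefPoly (d : DiscreteData N) (n : Fin N) : ℝ[X] :=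
  C (d.w n) * X + C (d.v n) * X ^ 2

/-- The value `φ₊(z, x_n)` as a polynomial in `z`. -/
noncomputable def nodePoly (d : DiscreteData N) (n : Fin N) : ℝ[X] :=
  C (Real.exp (-d.x n / 2)) + ∑ k : Fin N,
    if _h : n < k then
      d.coefPoly k * C (2 * Real.sinh ((d.x n - d.x k) / 2)) * nodePoly d k
    else 0
termination_by N - n.val
decreasing_by
  have := k.isLt
  have := n.isLt
  have : n.val < k.val := _h
  omega

/-- The coefficient of `e^{-x/2}` in `φ₊(z, x)` for `x` near `-∞`, as a polynomial in `z`. -/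
noncomputable def charPoly (d : DiscreteData N) : ℝ[X] :=
  1 - ∑ k, d.coefPoly k * C (Real.exp (d.x k / 2)) * d.nodePoly k

theorem aeval_coefPoly (d : DiscreteData N) (z : ℂ) (n : Fin N) :
    aeval z (d.coefPoly n) = d.coef z n := by
  simp [coefPoly, coef]
  ring

theorem aeval_nodePoly (d : DiscreteData N) (z : ℂ) (n : Fin N) :
    aeval z (d.nodePoly n) = d.phiPlusNode z n := by
  induction n using WellFoundedGT.induction with
  | ind n ih =>
    rw [nodePoly, phiPlusNode, map_add, map_sum]
    congr 1
    · simp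
    · refine Finset.sum_congr rfl fun k _ => ?_
      split_ifs with h
      · rw [map_mul, map_mul, ih k h, aeval_coefPoly, aeval_C]; rfl
      · simp

theorem aeval_charPoly (d : DiscreteData N) (z : ℂ) :
    aeval z d.charPoly =
      1 - ∑ k, d.coef z k * (Real.exp (d.x k / 2) : ℂ) * d.phiPlusNode z k := by
  rw [charPoly, map_sub, map_one, map_sum]
  congr 1
  refine Finset.sum_congr rfl fun k _ => ?_
  rw [map_mul, map_mul, aeval_nodePoly, aeval_coefPoly, aeval_C]; rfl

/-- Replacing `2 sinh((x - x_k)/2)` by the symmetric kernel changes each summand by a multiple of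
`e^{-x/2}`, and these multiples add up to `W(z)`. At a zero of `W` the equation becomes homogeneous,
so `φ₊` is bounded. -/
theorem phiPlus_eq_green (d : DiscreteData N) (z : ℂ) (x : ℝ) :
    d.phiPlus z x = aeval z d.charPoly * (Real.exp (-x / 2) : ℂ) +
      ∑ k, (green x (d.x k) : ℂ) * (d.coef z k * d.phiPlusNode z k) := by
  rw [phiPlus, aeval_charPoly, sub_mul, one_mul, sub_add, Finset.sum_mul, ← Finset.sum_sub_distrib,
    sub_eq_add_neg, ← Finset.sum_neg_distrib]
  congr 1
  refine Finset.sum_congr rfl fun k _ => ?_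
  split_ifs with h
  · rw [two_mul_sinh_half_sub _ _ h]
    push_cast; ring
  · rw [green_of_ge (le_of_not_ge h)]
    push_cast; ring

theorem phiPlusNode_eq_green (d : DiscreteData N) (z : ℂ) (n : Fin N) :
    d.phiPlusNode z n = aeval z d.charPoly * (Real.exp (-d.x n / 2) : ℂ) +
      ∑ k, (green (d.x n) (d.x k) : ℂ) * (d.coef z k * d.phiPlusNode z k) := by
  rw [← phiPlus_node, phiPlus_eq_green]

/-! ### Bounded solutions and the spectrum as a zero set. -/

/-- The weighted sum over the nodes to the left of `x`, the jump function of a solution. -/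
noncomputable def jumpSum (d : DiscreteData N) (a : Fin N → ℂ) (x : ℝ) : ℂ :=
  ∑ k, if d.x k < x then a k else 0

theorem jumpSum_eventually_left (d : DiscreteData N) (a : Fin N → ℂ) (x : ℝ) :
    ∀ᶠ y in 𝓝[<] x, d.jumpSum a y = d.jumpSum a x := by
  have : ∀ᶠ y in 𝓝[<] x, ∀ k, (d.x k < y ↔ d.x k < x) := by
    refine eventually_all.2 fun k => ?_
    by_cases h : d.x k < x
    · filter_upwards [nhdsWithin_le_nhds (lt_mem_nhds h)] with y hy
      simp [h, hy]
    · filter_upwards [self_mem_nhdsWithin] with y hy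
      simp [h, le_of_lt (lt_of_lt_of_le hy (not_lt.1 h))]
  filter_upwards [this] with y hy
  simp [jumpSum, hy]

theorem jumpSum_eventually_right (d : DiscreteData N) (a : Fin N → ℂ) (x : ℝ) :
    ∀ᶠ y in 𝓝[>] x, d.jumpSum a y = ∑ k, if d.x k ≤ x then a k else 0 := by
  have : ∀ᶠ y in 𝓝[>] x, ∀ k, (d.x k < y ↔ d.x k ≤ x) := by
    refine eventually_all.2 fun k => ?_
    by_cases h : d.x k ≤ x
    · filter_upwards [self_mem_nhdsWithin] with y hy
      simp [h, lt_of_le_of_lt h hy]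
    · filter_upwards [nhdsWithin_le_nhds (gt_mem_nhds (not_le.1 h))] with y hy
      simp [h, le_of_lt hy]
  filter_upwards [this] with y hy
  simp [jumpSum, hy]

theorem jumpSum_eventually (d : DiscreteData N) (a : Fin N → ℂ) {x : ℝ}
    (hx : x ∉ Set.range d.x) : ∀ᶠ y in 𝓝 x, d.jumpSum a y = d.jumpSum a x := by
  have e : d.jumpSum a x = ∑ k, if d.x k ≤ x then a k else 0 := by
    refine Finset.sum_congr rfl fun k _ => ?_
    have : d.x k ≠ x := fun h => hx ⟨k, h⟩
    simp [le_iff_lt_or_eq, this]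
  rw [← nhdsNE_sup_pure, ← nhdsLT_sup_nhdsGT]
  refine eventually_sup.2 ⟨eventually_sup.2 ⟨d.jumpSum_eventually_left a x, ?_⟩, by simp⟩
  rw [e]; exact d.jumpSum_eventually_right a x

theorem sum_le_eq_jumpSum_add (d : DiscreteData N) (a : Fin N → ℂ) (n : Fin N) :
    (∑ k, if d.x k ≤ d.x n then a k else 0) = d.jumpSum a (d.x n) + a n := by
  have : a n = ∑ k, if k = n then a k else 0 := by simp
  rw [this, jumpSum, ← Finset.sum_add_distrib]
  refine Finset.sum_congr rfl fun k _ => ?_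
  simp only [d.strictMono_x.le_iff_le, d.strictMono_x.lt_iff_lt]
  rcases lt_trichotomy k n with h | h | h
  · simp [h, h.le, h.ne]
  · subst h; simp
  · simp [not_le.2 h, not_lt.2 h.le, h.ne']

theorem eq_of_hasDerivAt_zero_off_nodes (d : DiscreteData N) {u : ℝ → ℂ} (hc : Continuous u)
    (hd : ∀ x, x ∉ Set.range d.x → HasDerivAt u 0 x) (x y : ℝ) : u x = u y := by
  have := integral_eq_of_hasDerivAt_off_countable u (fun _ => 0) (a := y) (b := x)
    (Set.finite_range d.x).countable hc.continuousOn (fun t ht => hd t ht.2) (by simp)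
  simpa [sub_eq_zero, eq_comm] using this

/-- For `s = ±1` the left side is the coefficient of `e^{-sx/2}` in `f`. It is constant between
nodes, and the interface condition prescribes its jumps; after subtracting them the function is
continuous with zero derivative off a finite set. -/
theorem exists_exp_coefficient (d : DiscreteData N) {z : ℂ} {f g : ℝ → ℂ} (hf : Continuous f)
    (hfg : ∀ x, x ∉ Set.range d.x → HasDerivAt f (g x) x ∧ HasDerivAt g (f x / 4) x)
    (hn : ∀ n, Tendsto g (𝓝[<] (d.x n)) (𝓝 (g (d.x n))) ∧
      ∃ b : ℂ, Tendsto g (𝓝[>] (d.x n)) (𝓝 b) ∧ g (d.x n) = b + d.coef z n * f (d.x n))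
    (s : ℝ) (hs : s ^ 2 = 1) :
    ∃ K : ℂ, ∀ x, (f x / 2 - s * g x) * (Real.exp (s * x / 2) : ℂ) =
      K + s * d.jumpSum (fun k => d.coef z k * f (d.x k) * (Real.exp (s * d.x k / 2) : ℂ)) x := by
  set a : Fin N → ℂ := fun k => d.coef z k * f (d.x k) * (Real.exp (s * d.x k / 2) : ℂ) with ha
  set u : ℝ → ℂ := fun x => (f x / 2 - s * g x) * (Real.exp (s * x / 2) : ℂ) -
    s * d.jumpSum a x with hu
  have hsC : (s : ℂ) ^ 2 = 1 := by exact_mod_cast hs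
  have E : ∀ x : ℝ, HasDerivAt (fun x : ℝ => (Real.exp (s * x / 2) : ℂ))
      ((s : ℂ) / 2 * (Real.exp (s * x / 2) : ℂ)) x := fun x => by
    have h : HasDerivAt (fun x : ℝ => Real.exp (s * x / 2)) (Real.exp (s * x / 2) * (s * 1 / 2)) x :=
      (((hasDerivAt_id x).const_mul s).div_const 2).exp
    convert h.ofReal_comp using 1
    push_cast; ring
  have hd : ∀ x, x ∉ Set.range d.x → HasDerivAt u 0 x := fun x hx => by
    have h1 := ((((hfg x hx).1.div_const 2).sub ((hfg x hx).2.const_mul (s : ℂ))).mul (E x)).sub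
      (((hasDerivAt_const x (d.jumpSum a x)).congr_of_eventuallyEq
        (d.jumpSum_eventually a hx)).const_mul (s : ℂ))
    refine h1.congr_deriv ?_
    simp only [Pi.sub_apply]
    linear_combination (-(g x) / 2 * (Real.exp (s * x / 2) : ℂ)) * hsC
  have hE : ∀ x : ℝ, Tendsto (fun x : ℝ => (Real.exp (s * x / 2) : ℂ)) (𝓝 x)
      (𝓝 (Real.exp (s * x / 2) : ℂ)) := fun x => (E x).continuousAt
  have hc : Continuous u := continuous_iff_continuousAt.2 fun x => by
    by_cases hx : x ∈ Set.range d.x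
    · obtain ⟨n, rfl⟩ := hx
      obtain ⟨hl, b, hr, hb⟩ := hn n
      rw [continuousAt_iff_continuous_left'_right']
      constructor
      · have h1 := ((((hf.tendsto (d.x n)).mono_left nhdsWithin_le_nhds).div_const 2).sub
          (hl.const_mul (s : ℂ))).mul ((hE (d.x n)).mono_left nhdsWithin_le_nhds)
        refine h1.sub ((tendsto_const_nhds.congr' ?_).const_mul (s : ℂ))
        exact (d.jumpSum_eventually_left a (d.x n)).mono fun _ h => h.symm
      · have h1 := ((((hf.tendsto (d.x n)).mono_left nhdsWithin_le_nhds).div_const 2).sub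
          (hr.const_mul (s : ℂ))).mul ((hE (d.x n)).mono_left nhdsWithin_le_nhds)
        have h2 := h1.sub (((tendsto_const_nhds (x := ∑ k, if d.x k ≤ d.x n then a k else 0)).congr'
          ((d.jumpSum_eventually_right a (d.x n)).mono fun _ h => h.symm)).const_mul (s : ℂ))
        unfold ContinuousWithinAt
        convert h2 using 2
        rw [hu, sum_le_eq_jumpSum_add]
        simp only [ha, hb]
        ring
    · exact (hd x hx).continuousAt
  refine ⟨u 0, fun x => ?_⟩
  rw [← d.eq_of_hasDerivAt_zero_off_nodes hc hd x 0, hu]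
  ring

theorem eq_zero_of_eventually_bounded {F : Filter ℝ} [F.NeBot] {K L : ℂ} {f : ℝ → ℂ} {M : ℝ}
    (hf : ∀ x, ‖f x‖ ≤ M) {e : ℝ → ℝ} (he : Tendsto e F (𝓝 0))
    (h : ∀ᶠ x in F, K = e x * f x + (e x : ℂ) ^ 2 * L) : K = 0 := by
  have he' : Tendsto (fun x => (e x : ℂ)) F (𝓝 0) := by
    simpa [Function.comp_def] using (Complex.continuous_ofReal.tendsto 0).comp he
  have h1 : Tendsto (fun x => (e x : ℂ) * f x) F (𝓝 0) :=
    he'.zero_mul_isBoundedUnder_le (isBoundedUnder_of ⟨M, hf⟩)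
  have h2 : Tendsto (fun x => (e x : ℂ) ^ 2 * L) F (𝓝 0) := by
    simpa using (he'.pow 2).mul_const L
  have h3 := (h1.add h2).congr' (h.mono fun _ h => h.symm)
  simpa using tendsto_nhds_unique tendsto_const_nhds h3

theorem bounded_solution_eq_green (d : DiscreteData N) {z : ℂ} {f : ℝ → ℂ}
    (hf : d.IsSolution z f) {M : ℝ} (hM : ∀ x, ‖f x‖ ≤ M) (x : ℝ) :
    f x = ∑ k, (green x (d.x k) : ℂ) * (d.coef z k * f (d.x k)) := by
  obtain ⟨hc, g, hfg, hn⟩ := hf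
  obtain ⟨K, hK⟩ := d.exists_exp_coefficient hc hfg hn 1 (by norm_num)
  obtain ⟨L, hL⟩ := d.exists_exp_coefficient hc hfg hn (-1) (by norm_num)
  set a : Fin N → ℂ := fun k => d.coef z k * f (d.x k) * (Real.exp (1 * d.x k / 2) : ℂ)
  set b : Fin N → ℂ := fun k => d.coef z k * f (d.x k) * (Real.exp (-1 * d.x k / 2) : ℂ)
  have hexp : ∀ x : ℝ, (Real.exp (-x / 2) : ℂ) * (Real.exp (x / 2) : ℂ) = 1 := fun x => by
    rw [← Complex.ofReal_mul, ← Real.exp_add]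
    simp [neg_div]
  have key : ∀ x, f x = (Real.exp (-x / 2) : ℂ) * (K + d.jumpSum a x) +
      (Real.exp (x / 2) : ℂ) * (L - d.jumpSum b x) := fun x => by
    have h1 := hK x
    have h2 := hL x
    simp only [Complex.ofReal_one, one_mul, Complex.ofReal_neg, neg_mul] at h1 h2
    linear_combination (-f x) * hexp x + (Real.exp (-x / 2) : ℂ) * h1 +
      (Real.exp (x / 2) : ℂ) * h2
  have hbot : ∀ᶠ x in atBot, ∀ k, x < d.x k := eventually_all.2 fun k => eventually_lt_atBot _
  have htop : ∀ᶠ x in atTop, ∀ k, d.x k < x := eventually_all.2 fun k => eventually_gt_atTop _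
  -- Left of all nodes `f = K e^{-x/2} + L e^{x/2}`, and boundedness excludes the first term.
  have hK0 : K = 0 := by
    refine eq_zero_of_eventually_bounded (F := atBot) (L := -L) (e := fun x => Real.exp (x / 2)) hM
      (Real.tendsto_exp_atBot.comp (tendsto_id.atBot_div_const (by norm_num))) ?_
    filter_upwards [hbot] with x hx
    have ha : ∀ c, d.jumpSum c x = 0 := fun c => by simp [jumpSum, fun k => not_lt.2 (hx k).le]
    rw [key x, ha, ha]
    linear_combination (-K) * hexp x
  -- Right of all nodes the coefficient of `e^{x/2}` is `L - ∑ b`, which boundedness excludes.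
  have hL0 : L - ∑ k, b k = 0 := by
    refine eq_zero_of_eventually_bounded (F := atTop) (L := -(K + ∑ k, a k))
      (e := fun x => Real.exp (-x / 2)) hM
      (Real.tendsto_exp_atBot.comp (tendsto_neg_atTop_atBot.atBot_div_const (by norm_num))) ?_
    filter_upwards [htop] with x hx
    have ha : ∀ c, d.jumpSum c x = ∑ k, c k := fun c => by simp [jumpSum, hx]
    rw [key x, ha, ha]
    linear_combination (-(L - ∑ k, b k)) * hexp x
  rw [key x, hK0, sub_eq_zero.1 hL0, zero_add, jumpSum, jumpSum, ← Finset.sum_sub_distrib,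
    Finset.mul_sum, Finset.mul_sum, ← Finset.sum_add_distrib]
  refine Finset.sum_congr rfl fun k _ => ?_
  split_ifs with h
  · rw [green_of_ge h.le]
    simp only [a, one_mul]
    push_cast; ring
  · rw [green_of_le (not_lt.1 h)]
    simp only [b, neg_mul, one_mul]
    push_cast; ring

/-- The homogeneous Green equation implies the right-to-left recursion of `φ₊`, with `e^{-x_n/2}`
multiplied by the constant in front. Thus eigenspaces are one-dimensional. -/
theorem node_eq_mul_phiPlusNode (d : DiscreteData N) {z : ℂ} {y : Fin N → ℂ}
    (hy : ∀ n, y n = ∑ k, (green (d.x n) (d.x k) : ℂ) * (d.coef z k * y k)) (n : Fin N) :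
    y n = (∑ k, d.coef z k * (Real.exp (d.x k / 2) : ℂ) * y k) * d.phiPlusNode z n := by
  set K := ∑ k, d.coef z k * (Real.exp (d.x k / 2) : ℂ) * y k with hK
  induction n using WellFoundedGT.induction with
  | ind n ih =>
    rw [hy n, phiPlusNode, mul_add, hK, Finset.sum_mul, ← hK, Finset.mul_sum,
      ← Finset.sum_add_distrib]
    refine Finset.sum_congr rfl fun k _ => ?_
    split_ifs with h
    · have := ih k h
      rw [two_mul_sinh_half_sub _ _ (d.strictMono_x h).le, Complex.ofReal_sub, Complex.ofReal_mul]
      linear_combination (-((green (d.x n) (d.x k) : ℂ) - (Real.exp (-d.x n / 2) : ℂ) *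
        (Real.exp (d.x k / 2) : ℂ)) * d.coef z k) * -this
    · rw [green_of_ge (d.strictMono_x.monotone (not_lt.1 h))]
      push_cast; ring

theorem phiPlusNode_ne_zero_of_root (d : DiscreteData N) {z : ℂ} (hz : aeval z d.charPoly = 0) :
    d.phiPlusNode z ≠ 0 := fun h => by
  rw [aeval_charPoly] at hz
  simp [h] at hz

/-- For an eigenfunction `f` with factor `K` relative to `φ₊`, substituting `f = K φ₊` into the sum
defining `K` gives `K W(z) = 0`, and `K = 0` would make `f` vanish. Conversely, at a zero of `W` the
function `φ₊` itself is bounded. -/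
theorem mem_spectrum_iff (d : DiscreteData N) (z : ℂ) :
    z ∈ d.spectrum ↔ aeval z d.charPoly = 0 := by
  constructor
  · rintro ⟨f, hf, hne, M, hM⟩
    have hg := d.bounded_solution_eq_green hf hM
    have hy := d.node_eq_mul_phiPlusNode (z := z) (y := fun k => f (d.x k)) fun n => hg (d.x n)
    set K := ∑ k, d.coef z k * (Real.exp (d.x k / 2) : ℂ) * f (d.x k) with hK
    have hK0 : K ≠ 0 := fun h0 => hne <| by
      funext x
      rw [hg x]
      refine Finset.sum_eq_zero fun k _ => ?_
      rw [hy k, h0]; ring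
    have : K = K * ∑ k, d.coef z k * (Real.exp (d.x k / 2) : ℂ) * d.phiPlusNode z k := by
      conv_lhs => rw [hK]
      rw [Finset.mul_sum]
      refine Finset.sum_congr rfl fun k _ => ?_
      rw [hy k]; ring
    rw [aeval_charPoly, sub_eq_zero]
    exact mul_left_cancel₀ hK0 (by rw [mul_one]; exact this)
  · intro hz
    refine ⟨d.phiPlus z, d.phiPlus_isSolution z, fun h => ?_,
      ∑ k, ‖d.coef z k * d.phiPlusNode z k‖, fun x => ?_⟩
    · refine d.phiPlusNode_ne_zero_of_root hz (funext fun n => ?_)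
      rw [← phiPlus_node, h]; rfl
    · rw [phiPlus_eq_green, hz, zero_mul, zero_add]
      refine (norm_sum_le _ _).trans (Finset.sum_le_sum fun k _ => ?_)
      rw [norm_mul, Complex.norm_real, Real.norm_of_nonneg (green_pos _ _).le]
      exact mul_le_of_le_one_left (norm_nonneg _) (green_le_one _ _)

/-! ### Positivity of the kernel, reality of the spectrum, sign of the norming constants. -/

/-- The kernel equals `e^{-x/2} min(e^x, e^y) e^{-y/2}`, a diagonal rescaling of the Brownian
covariance at times `e^x`. -/
theorem posSemidef_green (x : Fin N → ℝ) :
    (Matrix.of fun i j : Fin N => (green (x i) (x j) : ℂ)).PosSemidef := by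
  classical
  let t : Fin N → NNReal := fun i => ⟨Real.exp (x i), (Real.exp_pos _).le⟩
  let I : Finset NNReal := Finset.univ.image t
  let e : Fin N → I := fun i => ⟨t i, Finset.mem_image_of_mem _ (Finset.mem_univ i)⟩
  obtain ⟨m, B, hB⟩ := Matrix.posSemidef_iff_eq_sum_vecMulVec.1
    ((ProbabilityTheory.BrownianReal.posSemidef_covMatrix I).submatrix e)
  refine Matrix.posSemidef_iff_eq_sum_vecMulVec.2
    ⟨m, fun k i => ((Real.exp (-x i / 2) * B k i : ℝ) : ℂ), ?_⟩
  ext i j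
  have hij := congrFun (congrFun hB i) j
  have hmin : green (x i) (x j) =
      Real.exp (-x i / 2) * min (Real.exp (x i)) (Real.exp (x j)) * Real.exp (-x j / 2) := by
    rcases le_total (x i) (x j) with h | h
    · rw [green_of_le h, min_eq_left (Real.exp_le_exp.2 h), ← Real.exp_add, ← Real.exp_add,
        ← Real.exp_add]
      ring_nf
    · rw [green_of_ge h, min_eq_right (Real.exp_le_exp.2 h), ← Real.exp_add, ← Real.exp_add,
        ← Real.exp_add]
      ring_nf
  have hcov : min (Real.exp (x i)) (Real.exp (x j)) = ∑ k, B k i * B k j := by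
    simp only [Matrix.submatrix_apply, ProbabilityTheory.BrownianReal.covMatrix_apply,
      Matrix.sum_apply, Matrix.vecMulVec_apply, star_trivial] at hij
    exact hij
  rw [Matrix.of_apply, hmin, hcov, Matrix.sum_apply, Finset.mul_sum, Finset.sum_mul,
    Complex.ofReal_sum]
  refine Finset.sum_congr rfl fun k _ => ?_
  rw [Matrix.vecMulVec_apply, Pi.star_apply, RCLike.star_def, Complex.conj_ofReal,
    ← Complex.ofReal_mul]
  congr 1
  ring

theorem coef_eq_mul (d : DiscreteData N) (z : ℂ) (n : Fin N) :
    d.coef z n = z * ((d.w n : ℂ) + z * (d.v n : ℂ)) := by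
  rw [coef]; ring

theorem aeval_zero_charPoly (d : DiscreteData N) : aeval (0 : ℂ) d.charPoly = 1 := by
  rw [aeval_charPoly]
  simp [coef]

theorem ne_zero_of_root (d : DiscreteData N) {z : ℂ} (hz : aeval z d.charPoly = 0) : z ≠ 0 := by
  rintro rfl
  simp [aeval_zero_charPoly] at hz

/-- The energy identity for an eigenfunction. -/
theorem exists_energy (d : DiscreteData N) {z : ℂ} (hz : aeval z d.charPoly = 0) :
    ∃ E : ℝ, 0 < E ∧
      ∑ n, ((d.w n : ℂ) + (starRingEnd ℂ) z * (d.v n : ℂ)) *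
        ((‖d.phiPlusNode z n‖ ^ 2 : ℝ) : ℂ) = z * E := by
  set y := d.phiPlusNode z with hy
  set G : Matrix (Fin N) (Fin N) ℂ := Matrix.of fun i j => (green (d.x i) (d.x j) : ℂ) with hG
  set r : Fin N → ℂ := fun n => ((d.w n : ℂ) + z * (d.v n : ℂ)) * y n with hr
  have hGr : y = z • G.mulVec r := funext fun n => by
    have := d.phiPlusNode_eq_green z n
    rw [hz, zero_mul, zero_add] at this
    rw [hy, this, Pi.smul_apply, Matrix.mulVec, dotProduct, smul_eq_mul, Finset.mul_sum]
    refine Finset.sum_congr rfl fun k _ => ?_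
    simp only [hG, hr, coef_eq_mul, Matrix.of_apply]
    ring
  have hpsd : G.PosSemidef := posSemidef_green d.x
  have hnn := hpsd.dotProduct_mulVec_nonneg r
  -- Semidefiniteness is enough: if the form vanished at `r`, then `G r = 0`, and `y = z G r` would
  -- be zero.
  have hne : star r ⬝ᵥ G.mulVec r ≠ 0 := fun h0 => by
    rw [hpsd.dotProduct_mulVec_zero_iff] at h0
    exact d.phiPlusNode_ne_zero_of_root hz (by rw [← hy, hGr, h0, smul_zero])
  have hpos : 0 < star r ⬝ᵥ G.mulVec r := lt_of_le_of_ne hnn hne.symm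
  obtain ⟨hre, him⟩ := Complex.pos_iff.1 hpos
  refine ⟨(star r ⬝ᵥ G.mulVec r).re, hre, ?_⟩
  have hE : (((star r ⬝ᵥ G.mulVec r).re : ℝ) : ℂ) = star r ⬝ᵥ G.mulVec r :=
    Complex.ext (by simp) (by simp [← him])
  rw [hE]
  have : z * (star r ⬝ᵥ G.mulVec r) = star r ⬝ᵥ y := by
    conv_rhs => rw [hGr]
    rw [dotProduct_smul, smul_eq_mul]
  rw [this, dotProduct]
  refine Finset.sum_congr rfl fun n _ => ?_
  simp only [hr, Pi.star_apply, star_mul', RCLike.star_def, map_add, map_mul, Complex.conj_ofReal]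
  rw [← Complex.normSq_eq_norm_sq, mul_assoc, ← Complex.normSq_eq_conj_mul_self]

/-- The imaginary part of the energy identity is `-Im z ∑ υ_n |φ_n|² = E Im z`, where `E > 0` and
the sum is nonnegative. -/
theorem im_eq_zero_of_root (d : DiscreteData N) {z : ℂ} (hz : aeval z d.charPoly = 0) :
    z.im = 0 := by
  obtain ⟨E, hE, h⟩ := d.exists_energy hz
  have him := congrArg Complex.im h
  simp only [Complex.im_sum, Complex.mul_im, Complex.mul_re, Complex.add_re, Complex.add_im,
    Complex.ofReal_re, Complex.ofReal_im, Complex.conj_re, Complex.conj_im, mul_zero, sub_zero,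
    zero_add] at him
  have h1 : ∑ n, -z.im * d.v n * ‖d.phiPlusNode z n‖ ^ 2 =
      -z.im * ∑ n, d.v n * ‖d.phiPlusNode z n‖ ^ 2 := by
    rw [Finset.mul_sum]
    exact Finset.sum_congr rfl fun n _ => by ring
  rw [h1] at him
  have h2 : 0 ≤ ∑ n, d.v n * ‖d.phiPlusNode z n‖ ^ 2 :=
    Finset.sum_nonneg fun n _ => mul_nonneg (d.v_nonneg n) (sq_nonneg _)
  have h3 : z.im * (E + ∑ n, d.v n * ‖d.phiPlusNode z n‖ ^ 2) = 0 := by linarith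
  exact (mul_eq_zero.1 h3).resolve_right (by positivity)

theorem mul_normingConst_pos (d : DiscreteData N) {z : ℂ} (hz : aeval z d.charPoly = 0) :
    0 < z * d.normingConst z := by
  have him := d.im_eq_zero_of_root hz
  obtain ⟨l, rfl⟩ : ∃ l : ℝ, z = l := ⟨z.re, Complex.ext rfl (by simp [him])⟩
  have hl : l ≠ 0 := by simpa using d.ne_zero_of_root hz
  obtain ⟨E, hE, h⟩ := d.exists_energy hz
  have h2 : 0 ≤ ∑ n, d.v n * ‖d.phiPlusNode l n‖ ^ 2 :=
    Finset.sum_nonneg fun n _ => mul_nonneg (d.v_nonneg n) (sq_nonneg _)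
  have h3 : (l : ℂ) * d.normingConst l =
      ((l ^ 2 * (E + ∑ n, d.v n * ‖d.phiPlusNode l n‖ ^ 2) : ℝ) : ℂ) := by
    -- The norming constant exceeds the sum in the energy identity by `l ∑ υ_n |φ_n|²`, so `l γ_l²`
    -- is `l²` times a positive number.
    have h4 : d.normingConst l = ∑ n, ((d.w n : ℂ) + (starRingEnd ℂ) (l : ℂ) * (d.v n : ℂ)) *
        ((‖d.phiPlusNode l n‖ ^ 2 : ℝ) : ℂ) +
        l * ((∑ n, d.v n * ‖d.phiPlusNode l n‖ ^ 2 : ℝ) : ℂ) := by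
      rw [normingConst_eq_sum, Complex.ofReal_sum, Finset.mul_sum, ← Finset.sum_add_distrib]
      refine Finset.sum_congr rfl fun n _ => ?_
      rw [phiPlus_node, Complex.conj_ofReal]
      push_cast; ring
    rw [h4, h]
    push_cast; ring
  rw [h3]
  have : 0 < l ^ 2 * (E + ∑ n, d.v n * ‖d.phiPlusNode l n‖ ^ 2) := by positivity
  exact_mod_cast this

/-! ### The bilinear identity. -/

/-- The bilinear identity behind orthogonality of eigenfunctions and simplicity of
eigenvalues. -/
theorem charPoly_mul_eq (d : DiscreteData N) {l : ℝ} (hl : d.charPoly.eval l = 0) :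
    ∃ κ : ℝ, d.charPoly * C κ = (C l - X) *
      ∑ n, (C (d.w n) + (C l + X) * C (d.v n)) * C ((d.nodePoly n).eval l) * d.nodePoly n := by
  have hnode : ∀ n, d.nodePoly n = d.charPoly * C (Real.exp (-d.x n / 2)) +
      ∑ k, C (green (d.x n) (d.x k)) * (d.coefPoly k * d.nodePoly k) := fun n => by
    rw [nodePoly, charPoly, sub_mul, one_mul, Finset.sum_mul, sub_add, ← Finset.sum_sub_distrib,
      sub_eq_add_neg, ← Finset.sum_neg_distrib]
    congr 1
    refine Finset.sum_congr rfl fun k _ => ?_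
    split_ifs with h
    · rw [two_mul_sinh_half_sub _ _ (d.strictMono_x h).le, C_sub, C_mul]
      ring
    · rw [green_of_ge (d.strictMono_x.monotone (not_lt.1 h)), C_mul]
      ring
  set c : Fin N → ℝ := fun n => (d.coefPoly n).eval l with hc
  set y : Fin N → ℝ := fun n => (d.nodePoly n).eval l with hy
  have hyn : ∀ k, C (y k) = ∑ n, C (green (d.x n) (d.x k)) * (C (c n) * C (y n)) := fun k => by
    have := congrArg (fun p => C (p.eval l)) (hnode k)
    simp only [eval_add, eval_mul, hl, eval_finsetSum, eval_C, zero_mul, zero_add, map_sum,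
      C_mul] at this
    rw [hy, this]
    exact Finset.sum_congr rfl fun n _ => by rw [green_comm]
  -- Pair the Green equation for `φ(X)` with the vector `c_n φ_n(l)`. Symmetry of the kernel moves
  -- it onto the eigenvector at `l`, and `κ` collects the inhomogeneous terms. The factor `l - X`
  -- then comes from the difference of the coefficients at `l` and `X`.
  refine ⟨∑ n, c n * y n * Real.exp (-d.x n / 2), ?_⟩
  have h1 : ∑ n, C (c n) * C (y n) * d.nodePoly n =
      d.charPoly * C (∑ n, c n * y n * Real.exp (-d.x n / 2)) +
        ∑ k, d.coefPoly k * C (y k) * d.nodePoly k := by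
    have h2 : ∀ k, d.coefPoly k * C (y k) * d.nodePoly k =
        ∑ n, C (c n) * C (y n) * (C (green (d.x n) (d.x k)) * (d.coefPoly k * d.nodePoly k)) :=
      fun k => by
        rw [hyn k, Finset.mul_sum, Finset.sum_mul]
        exact Finset.sum_congr rfl fun n _ => by ring
    rw [Finset.sum_congr rfl fun k _ => h2 k, Finset.sum_comm, map_sum, Finset.mul_sum,
      ← Finset.sum_add_distrib]
    refine Finset.sum_congr rfl fun n _ => ?_
    conv_lhs => rw [hnode n]
    rw [mul_add, Finset.mul_sum]
    simp only [C_mul]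
    ring
  rw [← sub_eq_iff_eq_add, ← Finset.sum_sub_distrib] at h1
  rw [← h1, Finset.mul_sum]
  refine Finset.sum_congr rfl fun n _ => ?_
  have : c n = d.w n * l + d.v n * l ^ 2 := by simp [hc, coefPoly]
  rw [this, coefPoly]
  simp only [C_mul, C_add, C_pow]
  ring

/-! ### Degrees of the polynomials. -/

/-- The degree of the coefficient `z ω_n + z² υ_n`. -/
noncomputable def coefDegree (d : DiscreteData N) (n : Fin N) : ℕ := if d.v n = 0 then 1 else 2

/-- The sum of the degrees of the coefficients at the nodes from the `m`-th on. -/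
noncomputable def tailDegree (d : DiscreteData N) (m : ℕ) : ℕ :=
  ∑ k : Fin N, if m ≤ k.val then d.coefDegree k else 0

theorem coefDegree_pos (d : DiscreteData N) (n : Fin N) : 0 < d.coefDegree n := by
  rw [coefDegree]; split_ifs <;> norm_num

theorem w_ne_zero (d : DiscreteData N) {n : Fin N} (h : d.v n = 0) : d.w n ≠ 0 := fun h' => by
  have := d.weight_pos n
  simp [h, h'] at this

theorem natDegree_coefPoly (d : DiscreteData N) (n : Fin N) :
    (d.coefPoly n).natDegree = d.coefDegree n := by
  rw [coefPoly, coefDegree]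
  split_ifs with h
  · simp [h, natDegree_C_mul_X _ (d.w_ne_zero h)]
  · rw [natDegree_add_eq_right_of_natDegree_lt] <;> rw [natDegree_C_mul_X_pow _ _ h]
    exact ((natDegree_C_mul_le _ _).trans natDegree_X_le).trans_lt (by norm_num)

theorem coefPoly_ne_zero (d : DiscreteData N) (n : Fin N) : d.coefPoly n ≠ 0 :=
  ne_zero_of_natDegree_gt (n := 0) (by rw [natDegree_coefPoly]; exact d.coefDegree_pos n)

theorem sum_ite_le_eq_add {M : Type*} [AddCommMonoid M] (a : Fin N → M) (n : Fin N) :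
    (∑ k : Fin N, if n.val ≤ k.val then a k else 0) =
      a n + ∑ k : Fin N, if n.val + 1 ≤ k.val then a k else 0 := by
  have : a n = ∑ k, if k = n then a k else 0 := by simp
  rw [this, ← Finset.sum_add_distrib]
  refine Finset.sum_congr rfl fun k _ => ?_
  rcases lt_trichotomy n k with h | h | h
  · simp [h.ne', Nat.succ_le_of_lt h, Fin.le_of_lt h]
  · subst h; simp
  · have h1 : ¬ n.val ≤ k.val := not_le.2 h
    have h2 : ¬ n.val + 1 ≤ k.val := fun h' => h1 (by omega)
    rw [if_neg h1, if_neg h.ne, if_neg h2, add_zero]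

theorem tailDegree_eq_add (d : DiscreteData N) (n : Fin N) :
    d.tailDegree n = d.coefDegree n + d.tailDegree (n + 1) :=
  sum_ite_le_eq_add _ n

theorem tailDegree_of_le (d : DiscreteData N) {m : ℕ} (h : N ≤ m) : d.tailDegree m = 0 :=
  Finset.sum_eq_zero fun k _ => if_neg (by have := k.isLt; omega)

theorem tailDegree_antitone (d : DiscreteData N) : Antitone d.tailDegree := fun a b h =>
  Finset.sum_le_sum fun k _ => by
    by_cases h' : b ≤ k.val
    · rw [if_pos h', if_pos (h.trans h')]
    · rw [if_neg h']; exact Nat.zero_le _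

theorem tailDegree_le_of_lt (d : DiscreteData N) {n k : Fin N} (h : n < k) :
    d.tailDegree (k + 1) + d.coefDegree k ≤ d.tailDegree (n + 1) := by
  rw [add_comm, ← tailDegree_eq_add]
  exact d.tailDegree_antitone (Nat.succ_le_of_lt h)

/-- The intervals from `tailDegree (n + 1)` up to, but excluding, `tailDegree n` tile the degrees
below `tailDegree 0`. -/
theorem exists_tailDegree_le (d : DiscreteData N) {e : ℕ} (he : e < d.tailDegree 0) :
    ∃ n : Fin N, d.tailDegree (n + 1) ≤ e ∧ e < d.tailDegree (n + 1) + d.coefDegree n := by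
  have h : ∃ m, d.tailDegree m ≤ e := ⟨N, by rw [d.tailDegree_of_le le_rfl]; exact Nat.zero_le _⟩
  classical
  obtain ⟨m, hm, hmin⟩ : ∃ m, d.tailDegree m ≤ e ∧ ∀ j < m, ¬ d.tailDegree j ≤ e :=
    ⟨Nat.find h, Nat.find_spec h, fun j hj => Nat.find_min h hj⟩
  rcases m with _ | m
  · omega
  · have hlt := not_le.1 (hmin m (Nat.lt_succ_self m))
    have hN : m < N := by
      by_contra hc
      rw [d.tailDegree_of_le (not_lt.1 hc)] at hlt
      omega
    refine ⟨⟨m, hN⟩, hm, ?_⟩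
    rw [add_comm, ← tailDegree_eq_add]
    exact hlt

theorem tailDegree_zero (d : DiscreteData N) : d.tailDegree 0 = N + d.etaPlus := by
  classical
  have h : ∀ k : Fin N, (if 0 ≤ k.val then d.coefDegree k else 0) =
      1 + if d.v k ≠ 0 then 1 else 0 := fun k => by
    rw [if_pos (Nat.zero_le _), coefDegree]
    by_cases hv : d.v k = 0 <;> simp [hv]
  rw [tailDegree, Finset.sum_congr rfl fun k _ => h k, Finset.sum_add_distrib, etaPlus,
    ← Finset.card_filter, Set.ncard_eq_toFinset_card']
  simp

/-- Tail degrees decrease strictly, so the leftmost summand alone has top degree and nothing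
cancels. The statement covers both `nodePoly` and `charPoly`. -/
theorem natDegree_nodeSum (d : DiscreteData N) {m : ℕ} (a : ℝ) (b : Fin N → ℝ)
    (hb : ∀ k : Fin N, m ≤ k.val → b k ≠ 0)
    (hdeg : ∀ k : Fin N, m ≤ k.val →
      (d.nodePoly k).natDegree = d.tailDegree (k + 1) ∧ d.nodePoly k ≠ 0) :
    (C a + ∑ k : Fin N, if m ≤ k.val then d.coefPoly k * C (b k) * d.nodePoly k
      else 0).natDegree = d.tailDegree m := by
  by_cases hm : m < N
  · obtain ⟨n, rfl⟩ : ∃ n : Fin N, m = n.val := ⟨⟨m, hm⟩, rfl⟩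
    have hterm : ∀ k : Fin N, n.val ≤ k.val →
        (d.coefPoly k * C (b k) * d.nodePoly k).natDegree = d.tailDegree k := fun k hk => by
      rw [natDegree_mul (mul_ne_zero (d.coefPoly_ne_zero k) (C_ne_zero.2 (hb k hk)))
        (hdeg k hk).2, natDegree_mul_C (hb k hk), (hdeg k hk).1, natDegree_coefPoly,
        ← tailDegree_eq_add]
    have hlt : d.tailDegree (n + 1) < d.tailDegree n := by
      rw [d.tailDegree_eq_add n]
      have := d.coefDegree_pos n
      omega
    rw [sum_ite_le_eq_add, add_left_comm, natDegree_add_eq_left_of_natDegree_lt, hterm n le_rfl]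
    rw [hterm n le_rfl]
    refine lt_of_le_of_lt (natDegree_add_le_of_degree_le (n := d.tailDegree (n + 1)) ?_ ?_) hlt
    · rw [natDegree_C]; exact Nat.zero_le _
    · refine natDegree_sum_le_of_forall_le _ _ fun k _ => ?_
      split_ifs with hk
      · rw [hterm k (by omega)]
        exact d.tailDegree_antitone hk
      · simp
  · have : ∀ k : Fin N, ¬ m ≤ k.val := fun k => by have := k.isLt; omega
    simp [this, d.tailDegree_of_le (not_lt.1 hm)]

theorem natDegree_nodePoly_and_ne_zero (d : DiscreteData N) (n : Fin N) :
    (d.nodePoly n).natDegree = d.tailDegree (n + 1) ∧ d.nodePoly n ≠ 0 := by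
  induction n using WellFoundedGT.induction with
  | ind n ih =>
    have hrec : d.nodePoly n = C (Real.exp (-d.x n / 2)) + ∑ k : Fin N, if n.val + 1 ≤ k.val then
        d.coefPoly k * C (2 * Real.sinh ((d.x n - d.x k) / 2)) * d.nodePoly k else 0 := by
      conv_lhs => rw [nodePoly]
      rfl
    constructor
    · rw [hrec]
      refine d.natDegree_nodeSum _ _ (fun k hk => ?_) fun k hk => ih k hk
      have : d.x n < d.x k := d.strictMono_x hk
      have : Real.sinh ((d.x n - d.x k) / 2) < 0 := Real.sinh_neg_iff.2 (by linarith)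
      simp [this.ne]
    · intro h0
      have h1 := congrArg (eval 0) h0
      rw [hrec] at h1
      -- The coefficient polynomials vanish at `0`, so only the nonzero constant `e^{-x_n/2}`
      -- survives.
      have h2 : ∀ k : Fin N, eval 0 (if n.val + 1 ≤ k.val then
          d.coefPoly k * C (2 * Real.sinh ((d.x n - d.x k) / 2)) * d.nodePoly k else 0) = 0 :=
        fun k => by split_ifs <;> simp [coefPoly]
      rw [eval_add, eval_finsetSum, Finset.sum_eq_zero fun k _ => h2 k] at h1
      simp [Real.exp_ne_zero] at h1

theorem natDegree_nodePoly (d : DiscreteData N) (n : Fin N) :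
    (d.nodePoly n).natDegree = d.tailDegree (n + 1) := (d.natDegree_nodePoly_and_ne_zero n).1

theorem nodePoly_ne_zero (d : DiscreteData N) (n : Fin N) : d.nodePoly n ≠ 0 :=
  (d.natDegree_nodePoly_and_ne_zero n).2

theorem natDegree_charPoly (d : DiscreteData N) :
    d.charPoly.natDegree = d.tailDegree 0 := by
  rw [← d.natDegree_nodeSum 1 (fun k => -Real.exp (d.x k / 2)) (m := 0)
    (fun k _ => by simp [Real.exp_ne_zero]) fun k _ => d.natDegree_nodePoly_and_ne_zero k]
  congr 1
  rw [charPoly, sub_eq_add_neg, ← Finset.sum_neg_distrib]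
  congr 1
  refine Finset.sum_congr rfl fun k _ => ?_
  rw [if_pos (Nat.zero_le _), C_neg]
  ring

theorem charPoly_ne_zero (d : DiscreteData N) : d.charPoly ≠ 0 := fun h => by
  have := d.aeval_zero_charPoly
  simp [h] at this

/-! ### Simple real eigenvalues, their number, and orthogonality. -/

/-- The norming constant as a function of a real parameter. -/
noncomputable def realNorm (d : DiscreteData N) (l : ℝ) : ℝ :=
  ∑ n, (d.w n + 2 * l * d.v n) * (d.nodePoly n).eval l ^ 2

/-- The set of eigenvalues as a finite set of real numbers. -/
noncomputable def eigenvalues (d : DiscreteData N) : Finset ℝ := d.charPoly.roots.toFinset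

theorem mem_eigenvalues (d : DiscreteData N) {l : ℝ} :
    l ∈ d.eigenvalues ↔ d.charPoly.eval l = 0 := by
  simp [eigenvalues, d.charPoly_ne_zero]

theorem aeval_ofReal (p : ℝ[X]) (l : ℝ) : aeval (l : ℂ) p = ((p.eval l : ℝ) : ℂ) := by
  have := aeval_algebraMap_apply ℂ l p
  simpa [coe_aeval_eq_eval] using this

theorem spectrum_eq_image (d : DiscreteData N) :
    d.spectrum = Complex.ofReal '' (d.eigenvalues : Set ℝ) := by
  ext z
  rw [mem_spectrum_iff, Set.mem_image]
  constructor
  · intro hz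
    have hzr : ((z.re : ℝ) : ℂ) = z := Complex.ext rfl (by simp [d.im_eq_zero_of_root hz])
    refine ⟨z.re, ?_, hzr⟩
    rw [← hzr, aeval_ofReal] at hz
    exact d.mem_eigenvalues.2 (by exact_mod_cast hz)
  · rintro ⟨l, hl, rfl⟩
    rw [aeval_ofReal, d.mem_eigenvalues.1 hl, Complex.ofReal_zero]

theorem normingConst_ofReal (d : DiscreteData N) (l : ℝ) :
    d.normingConst l = d.realNorm l := by
  rw [normingConst_eq_sum, realNorm, Complex.ofReal_sum]
  refine Finset.sum_congr rfl fun n _ => ?_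
  rw [phiPlus_node, ← aeval_nodePoly, aeval_ofReal, Complex.norm_real, Real.norm_eq_abs, sq_abs]
  push_cast; ring

theorem mul_realNorm_pos (d : DiscreteData N) {l : ℝ} (hl : l ∈ d.eigenvalues) :
    0 < l * d.realNorm l := by
  have := d.mul_normingConst_pos (z := l) (by
    rw [aeval_ofReal, d.mem_eigenvalues.1 hl, Complex.ofReal_zero])
  rw [normingConst_ofReal] at this
  exact_mod_cast this

theorem realNorm_ne_zero (d : DiscreteData N) {l : ℝ} (hl : l ∈ d.eigenvalues) :
    d.realNorm l ≠ 0 := fun h => by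
  have := d.mul_realNorm_pos hl
  simp [h] at this

theorem eigenvalue_ne_zero (d : DiscreteData N) {l : ℝ} (hl : l ∈ d.eigenvalues) : l ≠ 0 :=
  fun h => by
    have := d.mul_realNorm_pos hl
    simp [h] at this

/-- Differentiating the bilinear identity at `l` gives `W'(l) κ = -γ_l²`, and the right side is
nonzero. -/
theorem eval_derivative_charPoly_ne_zero (d : DiscreteData N) {l : ℝ} (hl : l ∈ d.eigenvalues) :
    (derivative d.charPoly).eval l ≠ 0 := fun h => by
  obtain ⟨κ, hκ⟩ := d.charPoly_mul_eq (d.mem_eigenvalues.1 hl)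
  have h1 := congrArg (fun p => (derivative p).eval l) hκ
  simp only [derivative_mul, derivative_sub, derivative_C, derivative_X, eval_add, eval_mul,
    eval_sub, eval_C, eval_X, eval_neg, h, eval_finsetSum, sub_self, zero_mul, mul_zero,
    add_zero, zero_sub, neg_mul, one_mul] at h1
  refine d.realNorm_ne_zero hl ?_
  rw [realNorm, ← neg_eq_zero, h1, neg_inj]
  exact Finset.sum_congr rfl fun n _ => by ring

theorem separable_charPoly (d : DiscreteData N) : d.charPoly.Separable := by
  refine (isCoprime_iff_aeval_ne_zero_of_isAlgClosed ℝ ℂ _ _).2 fun z => ?_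
  by_contra! h
  have hz : z ∈ d.spectrum := (d.mem_spectrum_iff z).2 h.1
  rw [spectrum_eq_image] at hz
  obtain ⟨l, hl, rfl⟩ := hz
  refine d.eval_derivative_charPoly_ne_zero hl ?_
  have := h.2
  rw [aeval_ofReal] at this
  exact_mod_cast this

theorem ncard_spectrum (d : DiscreteData N) : d.spectrum.ncard = d.tailDegree 0 := by
  have h : d.spectrum = d.charPoly.rootSet ℂ := by
    ext z
    rw [mem_spectrum_iff, mem_rootSet_of_ne d.charPoly_ne_zero]
  rw [h, ← Nat.card_coe_set_eq, Nat.card_eq_fintype_card, card_rootSet_eq_natDegree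
    d.separable_charPoly (IsAlgClosed.splits _), natDegree_charPoly]

theorem card_eigenvalues (d : DiscreteData N) : d.eigenvalues.card = d.tailDegree 0 := by
  rw [← ncard_spectrum, spectrum_eq_image, Set.ncard_image_of_injective _ Complex.ofReal_injective,
    Set.ncard_coe_finset]

/-- Orthogonality of the eigenfunctions. -/
theorem sum_eigenfunctions (d : DiscreteData N) {l m : ℝ} (hl : l ∈ d.eigenvalues)
    (hm : m ∈ d.eigenvalues) :
    ∑ n, (d.w n + (l + m) * d.v n) * ((d.nodePoly n).eval l * (d.nodePoly n).eval m) =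
      if l = m then d.realNorm l else 0 := by
  split_ifs with h
  · subst h
    exact Finset.sum_congr rfl fun n _ => by ring
  · obtain ⟨κ, hκ⟩ := d.charPoly_mul_eq (d.mem_eigenvalues.1 hl)
    have h1 := congrArg (eval m) hκ
    simp only [eval_mul, d.mem_eigenvalues.1 hm, zero_mul, eval_sub, eval_C, eval_X,
      eval_finsetSum, eval_add] at h1
    have h2 := (mul_eq_zero.1 h1.symm).resolve_left (sub_ne_zero.2 h)
    rw [← h2]
    exact Finset.sum_congr rfl fun n _ => by ring

/-! ### The moment functional and biorthogonality. -/

/-- The moment functional `p ↦ ∑ p(λ) / γ_λ²`. -/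
noncomputable def momentFunctional (d : DiscreteData N) : ℝ[X] →ₗ[ℝ] ℝ :=
  ∑ l ∈ d.eigenvalues, (d.realNorm l)⁻¹ • leval l

theorem momentFunctional_apply (d : DiscreteData N) (p : ℝ[X]) :
    d.momentFunctional p = ∑ l ∈ d.eigenvalues, (d.realNorm l)⁻¹ * p.eval l := by
  simp [momentFunctional, leval_apply]

/-- The components of the eigenfunctions of the linearized pencil. -/
noncomputable def pencilPoly (d : DiscreteData N) : Fin N ⊕ {n // d.v n ≠ 0} → ℝ[X] :=
  Sum.elim d.nodePoly fun n => X * d.nodePoly n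

/-- The image of `pencilPoly` under the Gram matrix of the linearized pencil. -/
noncomputable def dualPencilPoly (d : DiscreteData N) : Fin N ⊕ {n // d.v n ≠ 0} → ℝ[X] :=
  Sum.elim (fun n => (C (d.w n) + C (d.v n) * X) * d.nodePoly n) fun n =>
    C (d.v n) * d.nodePoly n

theorem card_pencil_index (d : DiscreteData N) [Fintype {n // d.v n ≠ 0}] :
    Fintype.card (Fin N ⊕ {n // d.v n ≠ 0}) = d.tailDegree 0 := by
  rw [Fintype.card_sum, Fintype.card_fin, tailDegree_zero, etaPlus, ← Nat.card_coe_set_eq,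
    Nat.card_eq_fintype_card]
  congr 1
  exact Fintype.card_congr (Equiv.refl _)

/-- Biorthogonality with respect to the moment functional. -/
theorem momentFunctional_dual_mul (d : DiscreteData N) [DecidableEq {n // d.v n ≠ 0}]
    (i j : Fin N ⊕ {n // d.v n ≠ 0}) :
    d.momentFunctional (d.dualPencilPoly i * d.pencilPoly j) = if i = j then 1 else 0 := by
  classical
  let A : Matrix {l // l ∈ d.eigenvalues} (Fin N ⊕ {n // d.v n ≠ 0}) ℝ :=
    Matrix.of fun l i => (d.realNorm l)⁻¹ * (d.pencilPoly i).eval l.1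
  let Y : Matrix (Fin N ⊕ {n // d.v n ≠ 0}) {l // l ∈ d.eigenvalues} ℝ :=
    Matrix.of fun i l => (d.dualPencilPoly i).eval l.1
  -- The first block contributes `ω_n + m υ_n` and the second contributes `l υ_n`, so the entry is
  -- the orthogonality sum with weight `ω_n + (l + m) υ_n`.
  have hAY : A * Y = 1 := by
    ext l m
    have hsub : ∀ a : Fin N → ℝ, ∑ n : {n // d.v n ≠ 0}, a n * d.v n = ∑ n, a n * d.v n :=
      fun a => by
        rw [← Finset.sum_subtype (Finset.univ.filter fun n => d.v n ≠ 0) (by simp)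
          fun n => a n * d.v n, Finset.sum_filter]
        refine Finset.sum_congr rfl fun n _ => ?_
        by_cases h : d.v n = 0 <;> simp [h]
    have horth := d.sum_eigenfunctions l.2 m.2
    have h1 : (A * Y) l m = (d.realNorm l)⁻¹ *
        ∑ n, (d.w n + (l.1 + m) * d.v n) *
          ((d.nodePoly n).eval l.1 * (d.nodePoly n).eval m.1) := by
      rw [Matrix.mul_apply, Fintype.sum_sum_type]
      simp only [A, Y, Matrix.of_apply, pencilPoly, dualPencilPoly, Sum.elim_inl, Sum.elim_inr,
        eval_mul, eval_add, eval_C, eval_X]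
      have h2 := hsub fun n => (d.realNorm l)⁻¹ * (l.1 * (d.nodePoly n).eval l.1) *
        (d.nodePoly n).eval m.1
      have h3 : ∑ n : {n // d.v n ≠ 0}, (d.realNorm l)⁻¹ * (l.1 * (d.nodePoly n).eval l.1) *
          (d.v n * (d.nodePoly n).eval m.1) = ∑ n, (d.realNorm l)⁻¹ *
          (l.1 * (d.nodePoly n).eval l.1) * (d.nodePoly n).eval m.1 * d.v n := by
        rw [← h2]
        exact Finset.sum_congr rfl fun n _ => by ring
      rw [h3, ← Finset.sum_add_distrib, Finset.mul_sum]
      exact Finset.sum_congr rfl fun n _ => by ring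
    rw [h1, horth, Matrix.one_apply]
    by_cases h : l = m
    · rw [if_pos h, if_pos (congrArg Subtype.val h), inv_mul_cancel₀ (d.realNorm_ne_zero l.2)]
    · rw [if_neg h, if_neg fun h' => h (Subtype.ext h'), mul_zero]
  have hcard : Fintype.card {l // l ∈ d.eigenvalues} =
      Fintype.card (Fin N ⊕ {n // d.v n ≠ 0}) := by
    rw [card_pencil_index, Fintype.card_coe, card_eigenvalues]
  -- The matrices are square because `|σ| = N + η₊`, so a one-sided inverse is two-sided. The
  -- reversed product sums over eigenvalues, which is what `L` does.
  have hYA := (Matrix.mul_eq_one_comm_of_equiv (Fintype.equivOfCardEq hcard)).1 hAY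
  have hij := congrFun (congrFun hYA i) j
  rw [Matrix.mul_apply, Matrix.one_apply] at hij
  refine Eq.trans ?_ (hij.trans (by congr))
  rw [momentFunctional_apply, ← Finset.sum_coe_sort]
  refine Finset.sum_congr rfl fun l _ => ?_
  simp only [A, Y, Matrix.of_apply, eval_mul]
  ring

theorem momentFunctional_C_mul (d : DiscreteData N) (c : ℝ) (p : ℝ[X]) :
    d.momentFunctional (C c * p) = c * d.momentFunctional p := by
  rw [← smul_eq_C_mul, map_smul, smul_eq_mul]

/-- This includes `n = m`: each `φ_m` with `υ_m ≠ 0` is isotropic for the form, which is the source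
of the vanishing minors. -/
theorem momentFunctional_node_mul_node (d : DiscreteData N) {m : Fin N} (hm : d.v m ≠ 0)
    (n : Fin N) : d.momentFunctional (d.nodePoly n * d.nodePoly m) = 0 := by
  classical
  have h := d.momentFunctional_dual_mul (Sum.inr ⟨m, hm⟩) (Sum.inl n)
  rw [if_neg (by simp)] at h
  simp only [dualPencilPoly, pencilPoly, Sum.elim_inl, Sum.elim_inr] at h
  rw [mul_assoc, momentFunctional_C_mul, mul_eq_zero] at h
  rw [mul_comm]
  exact h.resolve_left hm

theorem momentFunctional_X_mul_node_mul_node (d : DiscreteData N) {m : Fin N} (hm : d.v m ≠ 0)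
    (n : Fin N) :
    d.momentFunctional (X * d.nodePoly n * d.nodePoly m) = if n = m then (d.v m)⁻¹ else 0 := by
  classical
  have h := d.momentFunctional_dual_mul (Sum.inl m) (Sum.inl n)
  simp only [dualPencilPoly, pencilPoly, Sum.elim_inl, Sum.inl.injEq] at h
  have e : (C (d.w m) + C (d.v m) * X) * d.nodePoly m * d.nodePoly n =
      C (d.w m) * (d.nodePoly n * d.nodePoly m) +
        C (d.v m) * (X * d.nodePoly n * d.nodePoly m) := by ring
  rw [e, map_add, momentFunctional_C_mul, momentFunctional_C_mul,
    d.momentFunctional_node_mul_node hm, mul_zero, zero_add] at h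
  by_cases hnm : n = m
  · rw [if_pos hnm.symm] at h
    rw [if_pos hnm]
    exact eq_inv_of_mul_eq_one_right h
  · rw [if_neg (Ne.symm hnm)] at h
    rw [if_neg hnm]
    exact (mul_eq_zero.1 h).resolve_left hm

theorem momentFunctional_node_mul_node_of_eq_zero (d : DiscreteData N) {m : Fin N}
    (hm : d.v m = 0) (n : Fin N) :
    d.momentFunctional (d.nodePoly n * d.nodePoly m) = if n = m then (d.w m)⁻¹ else 0 := by
  classical
  have h := d.momentFunctional_dual_mul (Sum.inl m) (Sum.inl n)
  simp only [dualPencilPoly, pencilPoly, Sum.elim_inl, Sum.inl.injEq, hm, C_0, zero_mul,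
    add_zero] at h
  rw [mul_assoc, momentFunctional_C_mul, mul_comm (d.nodePoly m)] at h
  by_cases hnm : n = m
  · rw [if_pos hnm.symm] at h
    rw [if_pos hnm]
    exact eq_inv_of_mul_eq_one_right h
  · rw [if_neg (Ne.symm hnm)] at h
    rw [if_neg hnm]
    exact (mul_eq_zero.1 h).resolve_left (d.w_ne_zero hm)

theorem momentFunctional_X_mul_node_mul_node_of_ne (d : DiscreteData N) {n m : Fin N}
    (hn : d.v n ≠ 0) (hnm : n ≠ m) :
    d.momentFunctional (X * d.nodePoly n * d.nodePoly m) = 0 := by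
  by_cases hm : d.v m = 0
  · classical
    have h := d.momentFunctional_dual_mul (Sum.inl m) (Sum.inr ⟨n, hn⟩)
    rw [if_neg (by simp)] at h
    simp only [dualPencilPoly, pencilPoly, Sum.elim_inl, Sum.elim_inr, hm, C_0, zero_mul,
      add_zero] at h
    rw [mul_assoc, momentFunctional_C_mul, mul_comm (d.nodePoly m)] at h
    exact (mul_eq_zero.1 h).resolve_left (d.w_ne_zero hm)
  · rw [d.momentFunctional_X_mul_node_mul_node hm, if_neg hnm]

theorem momentFunctional_X_mul_node_mul_X_mul_node (d : DiscreteData N) {n m : Fin N}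
    (hn : d.v n ≠ 0) (hm : d.v m ≠ 0) (hnm : n ≠ m) :
    d.momentFunctional (X * d.nodePoly n * (X * d.nodePoly m)) = 0 := by
  classical
  have h := d.momentFunctional_dual_mul (Sum.inl m) (Sum.inr ⟨n, hn⟩)
  rw [if_neg (by simp)] at h
  simp only [dualPencilPoly, pencilPoly, Sum.elim_inl, Sum.elim_inr] at h
  have e : (C (d.w m) + C (d.v m) * X) * d.nodePoly m * (X * d.nodePoly n) =
      C (d.w m) * (X * d.nodePoly n * d.nodePoly m) +
        C (d.v m) * (X * d.nodePoly n * (X * d.nodePoly m)) := by ring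
  rw [e, map_add, momentFunctional_C_mul, momentFunctional_C_mul,
    d.momentFunctional_X_mul_node_mul_node_of_ne hn hnm, mul_zero, zero_add] at h
  exact (mul_eq_zero.1 h).resolve_left hm

/-! ### Orthogonality to polynomials of lower degree. -/

theorem exists_degree_sub_C_mul_lt {q b : ℝ[X]} {n : ℕ} (hq : q.natDegree ≤ n) (hb : b ≠ 0)
    (hbn : b.natDegree = n) : ∃ r : ℝ[X], q = C (q.coeff n / b.leadingCoeff) * b + r ∧
      r.degree < n := by
  refine ⟨q - C (q.coeff n / b.leadingCoeff) * b, by ring, ?_⟩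
  rw [degree_lt_iff_coeff_zero]
  intro m hm
  rw [coeff_sub, coeff_C_mul]
  rcases hm.eq_or_lt with rfl | h
  · rw [leadingCoeff, hbn, div_mul_cancel₀, sub_self]
    rw [← hbn]
    exact leadingCoeff_ne_zero.2 hb
  · rw [coeff_eq_zero_of_natDegree_lt (hq.trans_lt h),
      coeff_eq_zero_of_natDegree_lt (hbn.trans_lt h)]
    ring

/-- One polynomial in each degree below `n` gives a triangular basis, so it suffices that `T`
vanishes on these. -/
theorem linearMap_eq_zero_of_degree_lt (T : ℝ[X] →ₗ[ℝ] ℝ) {n : ℕ}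
    (hT : ∀ e < n, ∃ b : ℝ[X], b ≠ 0 ∧ b.natDegree = e ∧ T b = 0) {q : ℝ[X]}
    (hq : q.degree < n) : T q = 0 := by
  induction n generalizing q with
  | zero =>
    have h0 := (degree_lt_iff_coeff_zero q 0).1 (by exact_mod_cast hq)
    rw [show q = 0 from ext fun m => h0 m (Nat.zero_le m), map_zero]
  | succ n ih =>
    obtain ⟨b, hb, hbn, hTb⟩ := hT n (Nat.lt_succ_self n)
    have hq' : q.natDegree ≤ n := natDegree_le_iff_coeff_eq_zero.2 fun m hm =>
      (degree_lt_iff_coeff_zero _ _).1 hq m hm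
    obtain ⟨r, hr, hrn⟩ := exists_degree_sub_C_mul_lt hq' hb hbn
    rw [hr, map_add, ih (fun e he => hT e (Nat.lt_succ_of_lt he)) hrn, ← smul_eq_C_mul, map_smul,
      hTb, smul_zero, add_zero]

theorem tailDegree_le_zero (d : DiscreteData N) (m : ℕ) : d.tailDegree m ≤ d.tailDegree 0 :=
  d.tailDegree_antitone (Nat.zero_le m)

/-- In every degree below `|σ|` there is one of the polynomials `φ_n` and (for
`υ_n ≠ 0`) `z φ_n`. -/
theorem degree_cases (d : DiscreteData N) {e : ℕ} (he : e < d.tailDegree 0) :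
    ∃ n : Fin N, e = d.tailDegree (n + 1) ∨ d.v n ≠ 0 ∧ e = d.tailDegree (n + 1) + 1 := by
  obtain ⟨n, h1, h2⟩ := d.exists_tailDegree_le he
  refine ⟨n, ?_⟩
  rw [coefDegree] at h2
  split_ifs at h2 with hv
  · left; omega
  · rcases h1.eq_or_lt with h | h
    · exact Or.inl h.symm
    · exact Or.inr ⟨hv, by omega⟩

theorem X_mul_nodePoly_ne_zero (d : DiscreteData N) (n : Fin N) : X * d.nodePoly n ≠ 0 :=
  mul_ne_zero X_ne_zero (d.nodePoly_ne_zero n)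

theorem natDegree_X_mul_nodePoly (d : DiscreteData N) (n : Fin N) :
    (X * d.nodePoly n).natDegree = d.tailDegree (n + 1) + 1 := by
  rw [natDegree_X_mul (d.nodePoly_ne_zero n), natDegree_nodePoly]

theorem momentFunctional_mul_node_of_degree_lt (d : DiscreteData N) (m : Fin N) {q : ℝ[X]}
    (hq : q.degree < (d.tailDegree (m + 1) : ℕ)) :
    d.momentFunctional (q * d.nodePoly m) = 0 := by
  refine linearMap_eq_zero_of_degree_lt
    (d.momentFunctional ∘ₗ LinearMap.mulRight ℝ (d.nodePoly m)) (fun e he => ?_) hq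
  simp only [LinearMap.comp_apply, LinearMap.mulRight_apply]
  obtain ⟨j, hj | ⟨hv, hj⟩⟩ := d.degree_cases (he.trans_le (d.tailDegree_le_zero _))
  · have hmj : j ≠ m := fun h => by rw [h] at hj; omega
    refine ⟨_, d.nodePoly_ne_zero j, by rw [natDegree_nodePoly, hj], ?_⟩
    by_cases hm : d.v m = 0
    · rw [d.momentFunctional_node_mul_node_of_eq_zero hm, if_neg hmj]
    · exact d.momentFunctional_node_mul_node hm j
  · have hmj : j ≠ m := fun h => by rw [h] at hj; omega
    exact ⟨_, d.X_mul_nodePoly_ne_zero j, by rw [natDegree_X_mul_nodePoly, hj],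
      d.momentFunctional_X_mul_node_mul_node_of_ne hv hmj⟩

/-- Isotropy of `φ_m` extends orthogonality from lower degrees to its own degree. -/
theorem momentFunctional_mul_node_of_degree_le (d : DiscreteData N) {m : Fin N} (hm : d.v m ≠ 0)
    {q : ℝ[X]} (hq : q.natDegree ≤ d.tailDegree (m + 1)) :
    d.momentFunctional (q * d.nodePoly m) = 0 := by
  obtain ⟨r, hr, hrn⟩ := exists_degree_sub_C_mul_lt hq (d.nodePoly_ne_zero m)
    (d.natDegree_nodePoly m)
  rw [hr, add_mul, map_add, d.momentFunctional_mul_node_of_degree_lt m hrn, mul_assoc,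
    momentFunctional_C_mul, d.momentFunctional_node_mul_node hm, mul_zero, add_zero]

theorem momentFunctional_mul_X_mul_node_of_degree_lt (d : DiscreteData N) {m : Fin N}
    (hm : d.v m ≠ 0) {q : ℝ[X]} (hq : q.degree < (d.tailDegree (m + 1) : ℕ)) :
    d.momentFunctional (q * (X * d.nodePoly m)) = 0 := by
  refine linearMap_eq_zero_of_degree_lt
    (d.momentFunctional ∘ₗ LinearMap.mulRight ℝ (X * d.nodePoly m)) (fun e he => ?_) hq
  simp only [LinearMap.comp_apply, LinearMap.mulRight_apply]
  obtain ⟨j, hj | ⟨hv, hj⟩⟩ := d.degree_cases (he.trans_le (d.tailDegree_le_zero _))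
  · have hmj : j ≠ m := fun h => by rw [h] at hj; omega
    refine ⟨_, d.nodePoly_ne_zero j, by rw [natDegree_nodePoly, hj], ?_⟩
    rw [← mul_assoc, mul_comm (d.nodePoly j) X, d.momentFunctional_X_mul_node_mul_node hm,
      if_neg hmj]
  · have hmj : j ≠ m := fun h => by rw [h] at hj; omega
    exact ⟨_, d.X_mul_nodePoly_ne_zero j, by rw [natDegree_X_mul_nodePoly, hj],
      d.momentFunctional_X_mul_node_mul_X_mul_node hv hm hmj⟩

/-- Nondegeneracy of the form in degrees below `k` when `k` cuts no `2 × 2` block. The test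
polynomial is the partner, within its block, of the basis element having the degree of `p`; the
remainder `r` is orthogonal to it. -/
theorem exists_momentFunctional_mul_ne_zero (d : DiscreteData N) {k : ℕ}
    (hk : k ≤ d.tailDegree 0) (hk' : ∀ n, d.v n ≠ 0 → k ≠ d.tailDegree (n + 1) + 1) {p : ℝ[X]}
    (hp : p ≠ 0) (hpk : p.natDegree < k) :
    ∃ q : ℝ[X], q.natDegree < k ∧ d.momentFunctional (p * q) ≠ 0 := by
  have hlead : ∀ {b : ℝ[X]}, b ≠ 0 → p.coeff p.natDegree / b.leadingCoeff ≠ 0 := fun hb =>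
    div_ne_zero (leadingCoeff_ne_zero.2 hp) (leadingCoeff_ne_zero.2 hb)
  obtain ⟨j, hj | ⟨hv, hj⟩⟩ := d.degree_cases (hpk.trans_le hk)
  · obtain ⟨r, hr, hrn⟩ := exists_degree_sub_C_mul_lt le_rfl (d.nodePoly_ne_zero j)
      ((d.natDegree_nodePoly j).trans hj.symm)
    have hl := hlead (d.nodePoly_ne_zero j)
    set c := p.coeff p.natDegree / (d.nodePoly j).leadingCoeff
    rw [hj] at hrn
    by_cases hv : d.v j = 0
    · refine ⟨d.nodePoly j, by rw [natDegree_nodePoly]; omega, ?_⟩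
      rw [hr, add_mul, map_add, d.momentFunctional_mul_node_of_degree_lt j hrn, mul_assoc,
        momentFunctional_C_mul, d.momentFunctional_node_mul_node_of_eq_zero hv, if_pos rfl, add_zero]
      exact mul_ne_zero hl (inv_ne_zero (d.w_ne_zero hv))
    -- The partner is one degree higher than `p`; it stays below `k` precisely because `k` does not
    -- cut this block.
    · refine ⟨X * d.nodePoly j, ?_, ?_⟩
      · have := hk' j hv
        rw [natDegree_X_mul_nodePoly]
        omega
      · rw [hr, add_mul, map_add, d.momentFunctional_mul_X_mul_node_of_degree_lt hv hrn, mul_assoc,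
          momentFunctional_C_mul, ← mul_assoc, mul_comm (d.nodePoly j) X,
          d.momentFunctional_X_mul_node_mul_node hv, if_pos rfl, add_zero]
        exact mul_ne_zero hl (inv_ne_zero hv)
  · obtain ⟨r, hr, hrn⟩ := exists_degree_sub_C_mul_lt le_rfl (d.X_mul_nodePoly_ne_zero j)
      ((d.natDegree_X_mul_nodePoly j).trans hj.symm)
    have hl := hlead (d.X_mul_nodePoly_ne_zero j)
    set c := p.coeff p.natDegree / (X * d.nodePoly j).leadingCoeff
    refine ⟨d.nodePoly j, by rw [natDegree_nodePoly]; omega, ?_⟩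
    have hrn' : r.natDegree ≤ d.tailDegree (j + 1) := by
      refine natDegree_le_iff_coeff_eq_zero.2 fun m hm =>
        (degree_lt_iff_coeff_zero _ _).1 hrn m (by omega)
    rw [hr, add_mul, map_add, d.momentFunctional_mul_node_of_degree_le hv hrn', mul_assoc,
      momentFunctional_C_mul, d.momentFunctional_X_mul_node_mul_node hv, if_pos rfl, add_zero]
    exact mul_ne_zero hl (inv_ne_zero hv)

/-! ### Hankel minors. -/

/-- The Hankel matrix of the moment functional. -/
noncomputable def hankelMatrix (d : DiscreteData N) (k : ℕ) : Matrix (Fin k) (Fin k) ℝ :=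
  Matrix.of fun i j => d.momentFunctional (X ^ (i.val + j.val))

theorem moment_succ (d : DiscreteData N) (k : ℕ) :
    d.moment (k + 1) = (d.momentFunctional (X ^ k) : ℂ) := by
  rw [moment, spectrum_eq_image, finsum_mem_image Complex.ofReal_injective.injOn,
    finsum_mem_coe_finset, momentFunctional_apply, Complex.ofReal_sum]
  refine Finset.sum_congr rfl fun l hl => ?_
  have h1 : (l : ℂ) ≠ 0 := by exact_mod_cast d.eigenvalue_ne_zero hl
  have h2 : (d.realNorm l : ℂ) ≠ 0 := by exact_mod_cast d.realNorm_ne_zero hl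
  rw [normingConst_ofReal, eval_pow, eval_X]
  rw [div_eq_iff (mul_ne_zero h1 h2)]
  push_cast
  rw [pow_succ]
  field_simp

theorem hankelMinor_eq (d : DiscreteData N) (k : ℕ) :
    d.hankelMinor k = ((d.hankelMatrix k).det : ℂ) := by
  have h := Complex.ofRealHom.map_det (d.hankelMatrix k)
  rw [Complex.ofRealHom_eq_coe] at h
  rw [h, hankelMinor]
  congr 1
  ext i j
  simp [hankelMatrix, moment_succ]

theorem hankelMatrix_mulVec (d : DiscreteData N) {k : ℕ} (a : Fin k → ℝ) (i : Fin k) :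
    (d.hankelMatrix k).mulVec a i =
      d.momentFunctional (X ^ i.val * ∑ j, C (a j) * X ^ j.val) := by
  rw [Matrix.mulVec, dotProduct, Finset.mul_sum, map_sum]
  refine Finset.sum_congr rfl fun j _ => ?_
  rw [mul_left_comm, momentFunctional_C_mul, ← pow_add, mul_comm]
  rfl

theorem det_hankelMatrix_eq_zero (d : DiscreteData N) {n : Fin N} (hn : d.v n ≠ 0) :
    (d.hankelMatrix (d.tailDegree (n + 1) + 1)).det = 0 := by
  rw [← Matrix.exists_mulVec_eq_zero_iff]
  -- The kernel vector consists of the coefficients of `φ_n`, which is orthogonal to all powers up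
  -- to its own degree.
  refine ⟨fun j => (d.nodePoly n).coeff j, fun h => ?_, funext fun i => ?_⟩
  · have := congrFun h ⟨d.tailDegree (n + 1), Nat.lt_succ_self _⟩
    rw [← natDegree_nodePoly] at this
    exact d.nodePoly_ne_zero n (leadingCoeff_eq_zero.1 this)
  · rw [hankelMatrix_mulVec, Fin.sum_univ_eq_sum_range fun j => C ((d.nodePoly n).coeff j) * X ^ j,
      ← as_sum_range_C_mul_X_pow' _ (by rw [natDegree_nodePoly]; exact Nat.lt_succ_self _),
      d.momentFunctional_mul_node_of_degree_le hn]
    · rfl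
    · rw [natDegree_X_pow]
      exact Nat.lt_succ_iff.1 i.isLt

theorem det_hankelMatrix_ne_zero (d : DiscreteData N) {k : ℕ}
    (hk : k ≤ d.tailDegree 0) (hk' : ∀ n, d.v n ≠ 0 → k ≠ d.tailDegree (n + 1) + 1) :
    (d.hankelMatrix k).det ≠ 0 := fun h => by
  obtain ⟨a, ha, h0⟩ := Matrix.exists_mulVec_eq_zero_iff.2 h
  set p : ℝ[X] := ∑ j, C (a j) * X ^ j.val with hp
  have hcoeff : ∀ j : Fin k, p.coeff j = a j := fun j => by
    rw [hp, finsetSum_coeff]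
    simp [coeff_C_mul, coeff_X_pow, Fin.val_inj]
  have hp0 : p ≠ 0 := fun h => ha <| _root_.funext fun j => by rw [← hcoeff, h]; rfl
  have hk0 : 0 < k := by
    rcases k with _ | k
    · exact absurd (Subsingleton.elim a 0) ha
    · exact Nat.succ_pos _
  have hpk : p.natDegree < k := by
    refine lt_of_le_of_lt (natDegree_sum_le_of_forall_le (n := k - 1) _ _ fun j _ => ?_)
      (Nat.sub_lt hk0 one_pos)
    exact (natDegree_C_mul_X_pow_le _ _).trans (Nat.le_sub_one_of_lt j.isLt)
  obtain ⟨q, hq, hne⟩ := d.exists_momentFunctional_mul_ne_zero hk hk' hp0 hpk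
  -- A kernel vector of the matrix is a polynomial `p` orthogonal to every monomial of degree below
  -- `k`, hence to `q`.
  refine hne ?_
  rw [mul_comm, as_sum_range_C_mul_X_pow' q hq, Finset.sum_mul, map_sum]
  refine Finset.sum_eq_zero fun i hi => ?_
  have := congrFun h0 ⟨i, Finset.mem_range.1 hi⟩
  rw [hankelMatrix_mulVec] at this
  rw [mul_assoc, momentFunctional_C_mul, this]
  exact mul_zero _

theorem hankelMinor_eq_zero_iff (d : DiscreteData N) {k : ℕ} (hk : k ≤ d.tailDegree 0) :
    d.hankelMinor k = 0 ↔ ∃ n, d.v n ≠ 0 ∧ k = d.tailDegree (n + 1) + 1 := by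
  rw [hankelMinor_eq, Complex.ofReal_eq_zero]
  constructor
  · intro h
    by_contra! hc
    exact d.det_hankelMatrix_ne_zero hk hc h
  · rintro ⟨n, hn, rfl⟩
    exact d.det_hankelMatrix_eq_zero hn

theorem tailDegree_add_one_le (d : DiscreteData N) (n : Fin N) :
    d.tailDegree (n + 1) + 1 ≤ d.tailDegree 0 := by
  refine le_trans ?_ (d.tailDegree_le_zero n)
  rw [d.tailDegree_eq_add n]
  have := d.coefDegree_pos n
  omega

theorem kappaZero_eq (d : DiscreteData N) : d.kappaZero = d.etaPlus := by
  have h : {k : ℕ | 1 ≤ k ∧ k ≤ d.spectrum.ncard ∧ d.hankelMinor k = 0} =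
      (fun n : Fin N => d.tailDegree (n + 1) + 1) '' {n | d.v n ≠ 0} := by
    ext k
    rw [Set.mem_ofPred_eq, ncard_spectrum]
    constructor
    · rintro ⟨_, hk, h⟩
      obtain ⟨n, hn, rfl⟩ := (d.hankelMinor_eq_zero_iff hk).1 h
      exact ⟨n, hn, rfl⟩
    · rintro ⟨n, hn, rfl⟩
      have hk := d.tailDegree_add_one_le n
      exact ⟨Nat.le_add_left _ _, hk, (d.hankelMinor_eq_zero_iff hk).2 ⟨n, hn, rfl⟩⟩
  rw [kappaZero, h, etaPlus]
  -- Strict decrease of the tail degrees makes distinct nodes yield distinct minors.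
  refine Set.ncard_image_of_injective _ fun n m hnm => ?_
  have hnm' : d.tailDegree (n + 1) + 1 = d.tailDegree (m + 1) + 1 := hnm
  rcases lt_trichotomy n m with h | h | h
  · have h1 := d.tailDegree_le_of_lt h
    have h2 := d.coefDegree_pos m
    omega
  · exact h
  · have h1 := d.tailDegree_le_of_lt h
    have h2 := d.coefDegree_pos n
    omega

/-- The Hankel determinants in the case `υ = 0`. -/
theorem det_hankelMatrix_mul (d : DiscreteData N) (hv : ∀ n, d.v n = 0) {k : ℕ} (hk : k ≤ N) :
    ∃ c : ℝ, c ≠ 0 ∧ (d.hankelMatrix k).det * c ^ 2 =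
      ∏ j : Fin k, (d.w (Fin.rev (Fin.castLE hk j)))⁻¹ := by
  have htail : ∀ m, m ≤ N → d.tailDegree (N - m) = m := fun m => by
    induction m with
    | zero => intro _; rw [d.tailDegree_of_le (by omega)]
    | succ m ih =>
      intro hm
      have h1 := d.tailDegree_eq_add ⟨N - (m + 1), by omega⟩
      simp only [coefDegree, hv, if_true] at h1
      rw [h1, show N - (m + 1) + 1 = N - m by omega, ih (by omega), add_comm]
  -- The order is reversed because the rightmost node has the constant polynomial; the `j`-th entry
  -- then has degree `j`.
  set b : Fin k → ℝ[X] := fun j => d.nodePoly (Fin.rev (Fin.castLE hk j)) with hb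
  have hdeg : ∀ j, (b j).natDegree = j := fun j => by
    rw [hb, natDegree_nodePoly, Fin.val_rev, Fin.val_castLE]
    have := j.isLt
    rw [show N - (j.val + 1) + 1 = N - j.val by omega, htail _ (by omega)]
  set T : Matrix (Fin k) (Fin k) ℝ := Matrix.of fun i j => (b j).coeff i with hT
  have hTdet : T.det = ∏ j, (b j).leadingCoeff := by
    rw [Matrix.det_of_isUpperTriangular]
    · exact Finset.prod_congr rfl fun j _ => by rw [leadingCoeff, hdeg]; rfl
    · intro i j hij
      exact coeff_eq_zero_of_natDegree_lt (by rw [hdeg]; exact hij)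
  -- The matrix `T` changes from the monomials to the orthogonal basis, in which the Hankel form is
  -- diagonal.
  have hgram : T.transpose * d.hankelMatrix k * T =
      Matrix.diagonal fun j => (d.w (Fin.rev (Fin.castLE hk j)))⁻¹ := by
    ext i j
    have hsum : ∀ j, b j = ∑ a : Fin k, C (T a j) * X ^ a.val := fun j => by
      refine (as_sum_range_C_mul_X_pow' (b j) (n := k) (by rw [hdeg]; exact j.isLt)).trans ?_
      exact (Fin.sum_univ_eq_sum_range (fun a => C ((b j).coeff a) * X ^ a) k).symm
    have h1 : (T.transpose * d.hankelMatrix k * T) i j = d.momentFunctional (b i * b j) := by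
      conv_rhs => rw [hsum i]
      rw [Matrix.mul_assoc, Matrix.mul_apply, Finset.sum_mul, map_sum]
      refine Finset.sum_congr rfl fun a _ => ?_
      rw [mul_assoc, momentFunctional_C_mul, Matrix.transpose_apply]
      congr 1
      conv_rhs => rw [hsum j]
      exact d.hankelMatrix_mulVec (fun a => T a j) a
    rw [h1, hb, d.momentFunctional_node_mul_node_of_eq_zero (hv _), Matrix.diagonal_apply]
    by_cases h : i = j
    · subst h; simp
    · rw [if_neg h, if_neg fun h' => h (Fin.castLE_injective hk (Fin.rev_injective h'))]
  refine ⟨T.det, ?_, ?_⟩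
  · rw [hTdet]
    exact Finset.prod_ne_zero_iff.2 fun j _ => leadingCoeff_ne_zero.2 (d.nodePoly_ne_zero _)
  · rw [← Matrix.det_diagonal, ← hgram, Matrix.det_mul, Matrix.det_mul, Matrix.det_transpose]
    ring

/-! ### Signs of the minors, and signs of the measures. -/

theorem forall_prod_pos_iff {n : ℕ} (a : Fin n → ℝ) :
    (∀ k ∈ Finset.Icc 1 n, ∀ hk : k ≤ n, 0 < ∏ j : Fin k, a (Fin.castLE hk j)) ↔ ∀ j, 0 < a j := by
  constructor
  · intro h j
    have h1 : 0 < ∏ i : Fin j.val, a (Fin.castLE j.isLt.le i) := by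
      rcases Nat.eq_zero_or_pos j.val with h0 | h0
      · have : IsEmpty (Fin j.val) := by rw [h0]; infer_instance
        simp
      · exact h _ (Finset.mem_Icc.2 ⟨h0, j.isLt.le⟩) _
    have h2 := h (j.val + 1) (Finset.mem_Icc.2 ⟨Nat.le_add_left _ _, j.isLt⟩) j.isLt
    rw [Fin.prod_univ_castSucc] at h2
    exact pos_of_mul_pos_right h2 h1.le
  · exact fun h k _ hk => Finset.prod_pos fun j _ => h _

/-- The sign `s = ±1` treats both halves of (iii) at once: up to a positive square, `s^k Δ_{1,k}` is
the product of the last `k` numbers `s / ω_n`. -/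
theorem forall_hankelMinor_pos_iff (d : DiscreteData N) (hv : ∀ n, d.v n = 0) (s : ℝ)
    (hs : s ^ 2 = 1) :
    (∀ k ∈ Finset.Icc 1 d.spectrum.ncard, 0 < (s : ℂ) ^ k * d.hankelMinor k) ↔
      ∀ n, 0 < s * d.w n := by
  have hcard : d.spectrum.ncard = N := by
    rw [ncard_spectrum, tailDegree_zero, etaPlus]
    simp [hv]
  have hs0 : s ≠ 0 := fun h => by simp [h] at hs
  have key := forall_prod_pos_iff fun j : Fin N => s * (d.w (Fin.rev j))⁻¹
  have hsw : ∀ n, 0 < s * (d.w n)⁻¹ ↔ 0 < s * d.w n := fun n => by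
    have hw := d.w_ne_zero (hv n)
    have : s * (d.w n)⁻¹ = s * d.w n * ((d.w n)⁻¹) ^ 2 := by field_simp
    rw [this]
    exact mul_pos_iff_of_pos_right (by positivity)
  have hright : (∀ j, 0 < s * (d.w (Fin.rev j))⁻¹) ↔ ∀ n, 0 < s * d.w n :=
    ⟨fun h n => by have := h (Fin.rev n); rwa [Fin.rev_rev, hsw] at this,
      fun h j => (hsw _).2 (h _)⟩
  rw [← hright, ← key, hcard]
  refine forall₂_congr fun k hk => ?_
  have hkN := (Finset.mem_Icc.1 hk).2
  obtain ⟨c, hc, h⟩ := d.det_hankelMatrix_mul hv hkN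
  rw [forall_prop_of_true hkN, Finset.prod_mul_distrib, ← h, Finset.prod_const, Finset.card_univ,
    Fintype.card_fin, ← mul_assoc, hankelMinor_eq,
    mul_pos_iff_of_pos_right (show 0 < c ^ 2 by positivity)]
  norm_cast

theorem upsilon_eq_zero_iff (d : DiscreteData N) : d.upsilon = 0 ↔ ∀ n, d.v n = 0 := by
  constructor
  · intro h n
    have h1 : d.upsilon {d.x n} = 0 := by rw [h]; rfl
    rw [upsilon, Measure.finsetSum_apply, Finset.sum_eq_zero_iff] at h1
    have h2 := h1 n (Finset.mem_univ n)
    simp at h2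
    exact le_antisymm h2 (d.v_nonneg n)
  · intro h
    simp [upsilon, h]

theorem omega_apply (d : DiscreteData N) {s : Set ℝ} (hs : MeasurableSet s) [DecidablePred (· ∈ s)] :
    d.omega s = ∑ n, if d.x n ∈ s then d.w n else 0 := by
  rw [omega, ← FunLike.coeAddMonoidHom_apply, map_sum, Finset.sum_apply]
  refine Finset.sum_congr rfl fun n _ => ?_
  split_ifs with h
  · exact VectorMeasure.dirac_apply_of_mem hs h
  · exact VectorMeasure.dirac_apply_of_notMem h

theorem omega_singleton (d : DiscreteData N) (n : Fin N) : d.omega {d.x n} = d.w n := by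
  classical
  rw [d.omega_apply (measurableSet_singleton _)]
  simp [d.strictMono_x.injective.eq_iff]

theorem omega_nonneg_iff (d : DiscreteData N) : 0 ≤ d.omega ↔ ∀ n, 0 ≤ d.w n := by
  classical
  constructor
  · intro h n
    have := h {d.x n} (measurableSet_singleton _)
    rwa [omega_singleton] at this
  · intro h s hs
    rw [d.omega_apply hs]
    exact Finset.sum_nonneg fun n _ => by split_ifs; exacts [h n, le_rfl]

theorem omega_nonpos_iff (d : DiscreteData N) : d.omega ≤ 0 ↔ ∀ n, d.w n ≤ 0 := by
  classical
  constructor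
  · intro h n
    have := h {d.x n} (measurableSet_singleton _)
    rwa [omega_singleton] at this
  · intro h s hs
    rw [d.omega_apply hs]
    exact Finset.sum_nonpos fun n _ => by split_ifs; exacts [h n, le_rfl]

end DiscreteData

end MultiPeakon

theorem mainTheorem3 {N : ℕ} (d : MultiPeakon.DiscreteData N) :
    -- the spectrum is finite and real with `λ γ_λ² > 0`, so that all quantities are well defined
    (d.spectrum.Finite ∧ ∀ l ∈ d.spectrum, l.im = 0 ∧ 0 < l * d.normingConst l) ∧
    -- (i)
    (d.upsilon = 0 ↔ ∀ k ∈ Finset.Icc 1 d.spectrum.ncard, d.hankelMinor k ≠ 0) ∧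
    -- (ii)
    (((d.spectrum.ncard : ℤ) - (N : ℤ) = (d.etaPlus : ℤ)) ∧ d.etaPlus = d.kappaZero) ∧
    -- (iii)
    (d.upsilon = 0 →
      ((0 ≤ d.omega ↔ ∀ k ∈ Finset.Icc 1 d.spectrum.ncard, 0 < d.hankelMinor k) ∧
        (d.omega ≤ 0 ↔ ∀ k ∈ Finset.Icc 1 d.spectrum.ncard,
          0 < (-1 : ℂ) ^ k * d.hankelMinor k))) := by
  refine ⟨⟨?_, fun l hl => ?_⟩, ?_, ⟨?_, d.kappaZero_eq.symm⟩, fun hv => ?_⟩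
  · rw [d.spectrum_eq_image]
    exact d.eigenvalues.finite_toSet.image _
  · have h := (d.mem_spectrum_iff l).1 hl
    exact ⟨d.im_eq_zero_of_root h, d.mul_normingConst_pos h⟩
  · rw [d.upsilon_eq_zero_iff, d.ncard_spectrum]
    constructor
    · intro h k hk h0
      obtain ⟨n, hn, _⟩ := (d.hankelMinor_eq_zero_iff (Finset.mem_Icc.1 hk).2).1 h0
      exact hn (h n)
    · intro h n
      by_contra hn
      have hk := d.tailDegree_add_one_le n
      exact h _ (Finset.mem_Icc.2 ⟨Nat.le_add_left _ _, hk⟩)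
        ((d.hankelMinor_eq_zero_iff hk).2 ⟨n, hn, rfl⟩)
  · rw [d.ncard_spectrum, d.tailDegree_zero]
    push_cast; ring
  · have hv' := d.upsilon_eq_zero_iff.1 hv
    -- With `υ = 0` no `ω_n` can vanish, so weak and strict sign conditions on the weights agree.
    have hw := fun n => d.w_ne_zero (hv' n)
    constructor
    · have h := d.forall_hankelMinor_pos_iff hv' 1 (by norm_num)
      simp only [Complex.ofReal_one, one_pow, one_mul] at h
      rw [d.omega_nonneg_iff, h]
      exact forall_congr' fun n => ⟨fun h => lt_of_le_of_ne h (hw n).symm, le_of_lt⟩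
    · have h := d.forall_hankelMinor_pos_iff hv' (-1) (by norm_num)
      simp only [Complex.ofReal_neg, Complex.ofReal_one, neg_one_mul, neg_pos] at h
      rw [d.omega_nonpos_iff, h]
      exact forall_congr' fun n => ⟨fun h => lt_of_le_of_ne h (hw n), le_of_lt⟩
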